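/- Let $F$ be a field of characteristic zero and let $A = UT_4(F)$ be the algebra of upper triangular $4\times 4$ matrices over $F$, with the elementary $\mathbb{Z}_2$-grading induced by $(g_1,g_2,g_3,g_4)=(0,1,0,1)$ (for $k \le j$ the matrix unit $e_{kj}$ has degree $g_k+g_j \bmod 2$), endowed with the super-symplectic superinvolution $$ \begin{pmatrix} a & b & c & d \\ 0 & e & f & g \\ 0 & 0 & h & i \\ 0 & 0 & 0 & l \end{pmatrix}^{*} = \begin{pmatrix} l & i & g & d \\ 0 & h & -f & c \\ 0 & 0 & e & b \\ 0 & 0 & 0 & a \end{pmatrix}. $$ Write $A_i^{\pm}=\{a\in A_i : a^*=\pm a\}$ for $i=0,1$. Let $F\langle Y\cup Z,*\rangle$ be the free algebra on the variables $y_i^+,y_i^-,z_i^+,z_i^-$; let $\mathrm{Id}^*(A)$ be the set of its polynomials that vanish under every substitution of elements of $A_0^+,A_0^-,A_1^+,A_1^-$ for the variables $y_i^+,y_i^-,z_i^+,z_i^-$ respectively; let $P_n^*$ be the span of the monomials $w_{\sigma(1)}\cdots w_{\sigma(n)}$ with $\sigma\in S_n$ and $w_i\in\{y_i^+,y_i^-,z_i^+,z_i^-\}$;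 and let $c_n^*(A)=\dim_F P_n^*/(P_n^*\cap \mathrm{Id}^*(A))$ be the $n$-th $*$-codimension of $A$. Then, for every $n\ge 1$, $$ c_n^*(A) = 2^{n}(n+2) - 2^{n-2}n(n-1) + 2^{2n-1}(n^2-2) + 2^{2n-5}n(n-1)(n-2). $$ Consequently the $*$-exponent of $A$ is $\exp^*(A)=\lim_{n\to\infty}\sqrt[n]{c_n^*(A)}=4$. -/

import Mathlib

namespace SuperStar

/-! ## Superalgebras with superinvolution -/

section General

variable {F A : Type*} [Field F] [Ring A] [Algebra F A]

/-- A superinvolution on a superalgebra `A = A₀ ⊕ A₁` over `F`: a linear map of order at most two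
that preserves the grading and satisfies `(ab)* = (-1)^{|a||b|} b* a*` on homogeneous elements. -/
structure Superinvolution (𝒜 : ZMod 2 → Submodule F A) [GradedAlgebra 𝒜] where
  toLinearMap : A →ₗ[F] A
  map_mem : ∀ (i : ZMod 2) (a : A), a ∈ 𝒜 i → toLinearMap a ∈ 𝒜 i
  involutive : ∀ a : A, toLinearMap (toLinearMap a) = a
  map_mul : ∀ (i j : ZMod 2) (a b : A), a ∈ 𝒜 i → b ∈ 𝒜 j →
    toLinearMap (a * b) = (-1 : F) ^ (i.val * j.val) • (toLinearMap b * toLinearMap a)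

/-- The four kinds of variables `y⁺`, `y⁻`, `z⁺`, `z⁻` of the free `*`-algebra. -/
inductive VarKind : Type
  | evenSymm
  | evenSkew
  | oddSymm
  | oddSkew

/-- The homogeneous degree of a kind of variables. -/
def VarKind.degree : VarKind → ZMod 2
  | evenSymm => 0
  | evenSkew => 0
  | oddSymm => 1
  | oddSkew => 1

/-- The sign `ε` such that variables `x` of the given kind satisfy `x* = ε x`. -/
def VarKind.sign : VarKind → ℤˣ
  | evenSymm => 1
  | evenSkew => -1
  | oddSymm => 1
  | oddSkew => -1

variable (F) in
/-- The (underlying algebra of the) free `*`-algebra over `F`, freely generated by the variables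
`y_i⁺`, `y_i⁻`, `z_i⁺`, `z_i⁻`, with `i` in `ℕ`. -/
abbrev FreeStarAlgebra : Type _ := FreeAlgebra F (VarKind × ℕ)

variable {𝒜 : ZMod 2 → Submodule F A} [GradedAlgebra 𝒜]

/-- The subspaces `A₀⁺`, `A₀⁻`, `A₁⁺`, `A₁⁻` of `A`: the homogeneous symmetric, respectively skew,
elements of the degree and sign of the given kind of variables. -/
def Superinvolution.part (s : Superinvolution 𝒜) (k : VarKind) : Submodule F A where
  carrier := {a | a ∈ 𝒜 k.degree ∧ s.toLinearMap a = k.sign • a}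
  zero_mem' := ⟨Submodule.zero_mem _, by simp⟩
  add_mem' := by
    rintro a b ⟨ha, ha'⟩ ⟨hb, hb'⟩
    exact ⟨Submodule.add_mem _ ha hb, by rw [map_add, ha', hb', smul_add]⟩
  smul_mem' := by
    rintro c a ⟨ha, ha'⟩
    exact ⟨Submodule.smul_mem _ c ha, by rw [map_smul, ha', smul_comm]⟩

/-- The space `Id*(A)` of the `*`-identities of `A`: the polynomials that vanish whenever each
variable is replaced by an element of the homogeneous symmetric or skew part of its kind. -/
def Superinvolution.identities (s : Superinvolution 𝒜) : Submodule F (FreeStarAlgebra F) where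
  carrier := {f | ∀ u : VarKind × ℕ → A, (∀ k i, u (k, i) ∈ s.part k) →
    FreeAlgebra.lift F u f = 0}
  zero_mem' := fun _ _ => map_zero _
  add_mem' := fun hf hg u hu => by rw [map_add, hf u hu, hg u hu, add_zero]
  smul_mem' := fun c f hf u hu => by rw [map_smul, hf u hu, smul_zero]

variable (F) in
/-- The space `P_n*` of multilinear polynomials of degree `n`, spanned by the monomials
`w_{σ(1)} ⋯ w_{σ(n)}` with `σ` a permutation and `w_i ∈ {y_i⁺, y_i⁻, z_i⁺, z_i⁻}`. -/
def multilinearPolynomials (n : ℕ) : Submodule F (FreeStarAlgebra F) :=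
  Submodule.span F {f | ∃ (σ : Equiv.Perm (Fin n)) (w : Fin n → VarKind),
    f = (List.ofFn fun i : Fin n => FreeAlgebra.ι F (w (σ i), (σ i : ℕ))).prod}

/-- The `n`-th `*`-codimension `c_n*(A) = dim P_n* / (P_n* ∩ Id*(A))`. -/
noncomputable def Superinvolution.codimension (s : Superinvolution 𝒜) (n : ℕ) : ℕ :=
  Module.finrank F
    (multilinearPolynomials F n ⧸ s.identities.submoduleOf (multilinearPolynomials F n))

end General

/-! ## Upper triangular matrices -/

section UpperTriangular

variable (F : Type*) [Field F]

/-- The algebra `UT_n(F)` of upper triangular `n × n` matrices. -/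
abbrev UT (n : ℕ) : Subalgebra F (Matrix (Fin n) (Fin n) F) :=
  Matrix.blockTriangularSubalgebra F F (id : Fin n → Fin n)

/-- The elementary `ℤ/2`-grading on `UT_n(F)` defined by `g = (g_1, …, g_n)`: the component of
degree `d` consists of the upper triangular matrices supported on the positions `(k, j)` with
`g_k + g_j = d`. -/
def elementaryGrading {n : ℕ} (g : Fin n → ZMod 2) (d : ZMod 2) : Submodule F (UT F n) where
  carrier := {M | ∀ k j : Fin n, g k + g j ≠ d → M.1 k j = 0}
  zero_mem' := fun _ _ _ => rfl
  add_mem' := fun ha hb k j h => by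
    simp [ha k j h, hb k j h]
  smul_mem' := fun c M ha k j h => by
    simp [ha k j h]

instance elementaryGrading.gradedMonoid {n : ℕ} (g : Fin n → ZMod 2) :
    SetLike.GradedMonoid (elementaryGrading F g) where
  one_mem := by
    intro k j h
    have hkj : k ≠ j := by
      rintro rfl
      exact h (CharTwo.add_self_eq_zero _)
    simp [Matrix.one_apply_ne hkj]
  mul_mem := by
    intro i j a b ha hb k l h
    change (a.1 * b.1) k l = 0
    rw [Matrix.mul_apply]
    refine Finset.sum_eq_zero fun m _ => ?_
    by_cases h1 : g k + g m = i
    · by_cases h2 : g m + g l = j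
      · exfalso
        apply h
        rw [← h1, ← h2]
        have := CharTwo.add_self_eq_zero (g m)
        linear_combination -this
      · rw [hb m l h2, mul_zero]
    · rw [ha k m h1, zero_mul]

theorem elementaryGrading.isInternal {n : ℕ} (g : Fin n → ZMod 2) :
    DirectSum.IsInternal (elementaryGrading F g) := by
  have h01 : (0 : ZMod 2) ≠ 1 := by decide
  have huniv : (Set.univ : Set (ZMod 2)) = {0, 1} := by
    ext x
    revert x
    simp only [Set.mem_univ, Set.mem_insert_iff, Set.mem_singleton_iff, true_iff]
    decide
  rw [DirectSum.isInternal_submodule_iff_isCompl _ h01 huniv]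
  constructor
  · rw [Submodule.disjoint_def]
    intro M h0 h1
    apply Subtype.ext
    ext k j
    by_cases h : g k + g j = 0
    · exact h1 k j (by rw [h]; exact h01)
    · exact h0 k j h
  · rw [codisjoint_iff, Submodule.eq_top_iff']
    intro M
    rw [Submodule.mem_sup]
    refine ⟨⟨Matrix.of fun k j => if g k + g j = 0 then M.1 k j else 0, ?_⟩, ?_,
      ⟨Matrix.of fun k j => if g k + g j = 0 then 0 else M.1 k j, ?_⟩, ?_, ?_⟩
    · intro k j h
      have := M.2 h
      simp [this]
    · intro k j h
      simp [h]
    · intro k j h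
      have := M.2 h
      simp [this]
    · intro k j h
      have h' : g k + g j = 0 := by
        revert h
        generalize g k + g j = x
        revert x
        decide
      simp [h']
    · apply Subtype.ext
      ext k j
      by_cases h : g k + g j = 0 <;> simp [h]

noncomputable instance elementaryGrading.gradedAlgebra {n : ℕ} (g : Fin n → ZMod 2) :
    GradedAlgebra (elementaryGrading F g) :=
  { elementaryGrading.gradedMonoid F g with
    toDecomposition := (elementaryGrading.isInternal F g).chooseDecomposition }

/-- The elementary grading on `UT_4(F)` defined by `(0, 1, 0, 1)`. -/
abbrev grading0101 : ZMod 2 → Submodule F (UT F 4) :=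
  elementaryGrading F ![0, 1, 0, 1]

theorem zmod_two_cases (x : ZMod 2) : x = 0 ∨ x = 1 := by
  revert x
  decide

theorem grading0101.even_form {a : UT F 4} (ha : a ∈ grading0101 F 0) :
    a.1 = !![a.1 0 0, 0, a.1 0 2, 0;
             0, a.1 1 1, 0, a.1 1 3;
             0, 0, a.1 2 2, 0;
             0, 0, 0, a.1 3 3] := by
  have T : ∀ k j : Fin 4, j < k → a.1 k j = 0 := fun k j h => a.2 h
  ext k j
  fin_cases k <;> fin_cases j <;> first
    | rfl
    | exact T _ _ (by decide)
    | exact ha 0 1 (by decide)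
    | exact ha 0 3 (by decide)
    | exact ha 1 2 (by decide)
    | exact ha 2 3 (by decide)

theorem grading0101.odd_form {a : UT F 4} (ha : a ∈ grading0101 F 1) :
    a.1 = !![0, a.1 0 1, 0, a.1 0 3;
             0, 0, a.1 1 2, 0;
             0, 0, 0, a.1 2 3;
             0, 0, 0, 0] := by
  have T : ∀ k j : Fin 4, j < k → a.1 k j = 0 := fun k j h => a.2 h
  ext k j
  fin_cases k <;> fin_cases j <;> first
    | rfl
    | exact T _ _ (by decide)
    | exact ha 0 0 (by decide)
    | exact ha 1 1 (by decide)
    | exact ha 2 2 (by decide)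
    | exact ha 3 3 (by decide)
    | exact ha 0 2 (by decide)
    | exact ha 1 3 (by decide)

/-- The formula of the super-symplectic superinvolution on `4 × 4` upper triangular matrices. -/
def superSymplecticMatrix (M : Matrix (Fin 4) (Fin 4) F) : Matrix (Fin 4) (Fin 4) F :=
  !![M 3 3, M 2 3, M 1 3, M 0 3;
     0, M 2 2, -M 1 2, M 0 2;
     0, 0, M 1 1, M 0 1;
     0, 0, 0, M 0 0]

theorem superSymplecticMatrix.entries (M : Matrix (Fin 4) (Fin 4) F) :
    superSymplecticMatrix F M 0 0 = M 3 3 ∧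
    superSymplecticMatrix F M 0 1 = M 2 3 ∧
    superSymplecticMatrix F M 0 2 = M 1 3 ∧
    superSymplecticMatrix F M 0 3 = M 0 3 ∧
    superSymplecticMatrix F M 1 0 = 0 ∧
    superSymplecticMatrix F M 1 1 = M 2 2 ∧
    superSymplecticMatrix F M 1 2 = -M 1 2 ∧
    superSymplecticMatrix F M 1 3 = M 0 2 ∧
    superSymplecticMatrix F M 2 0 = 0 ∧
    superSymplecticMatrix F M 2 1 = 0 ∧
    superSymplecticMatrix F M 2 2 = M 1 1 ∧
    superSymplecticMatrix F M 2 3 = M 0 1 ∧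
    superSymplecticMatrix F M 3 0 = 0 ∧
    superSymplecticMatrix F M 3 1 = 0 ∧
    superSymplecticMatrix F M 3 2 = 0 ∧
    superSymplecticMatrix F M 3 3 = M 0 0 :=
  ⟨rfl, rfl, rfl, rfl, rfl, rfl, rfl, rfl, rfl, rfl, rfl, rfl, rfl, rfl, rfl, rfl⟩

theorem mul_apply_four (M N : Matrix (Fin 4) (Fin 4) F) (k l : Fin 4) :
    (M * N) k l = M k 0 * N 0 l + M k 1 * N 1 l + M k 2 * N 2 l + M k 3 * N 3 l := by
  rw [Matrix.mul_apply, Fin.sum_univ_four]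

theorem forall_fin_four {P : Fin 4 → Prop} (h0 : P 0) (h1 : P 1) (h2 : P 2) (h3 : P 3) :
    ∀ k, P k := by
  intro k
  fin_cases k
  exacts [h0, h1, h2, h3]

/-- The entries of an even matrix that vanish. -/
theorem grading0101.even_zero {a : UT F 4} (ha : a ∈ grading0101 F 0) :
    a.1 0 1 = 0 ∧ a.1 0 3 = 0 ∧ a.1 1 2 = 0 ∧ a.1 2 3 = 0 :=
  ⟨ha 0 1 (by decide), ha 0 3 (by decide), ha 1 2 (by decide), ha 2 3 (by decide)⟩

/-- The entries of an odd matrix that vanish. -/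
theorem grading0101.odd_zero {a : UT F 4} (ha : a ∈ grading0101 F 1) :
    a.1 0 0 = 0 ∧ a.1 1 1 = 0 ∧ a.1 2 2 = 0 ∧ a.1 3 3 = 0 ∧
      a.1 0 2 = 0 ∧ a.1 1 3 = 0 :=
  ⟨ha 0 0 (by decide), ha 1 1 (by decide), ha 2 2 (by decide),
    ha 3 3 (by decide), ha 0 2 (by decide), ha 1 3 (by decide)⟩

theorem UT.lower_zero (a : UT F 4) :
    a.1 1 0 = 0 ∧ a.1 2 0 = 0 ∧ a.1 2 1 = 0 ∧
      a.1 3 0 = 0 ∧ a.1 3 1 = 0 ∧ a.1 3 2 = 0 :=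
  ⟨a.2 (by decide), a.2 (by decide), a.2 (by decide), a.2 (by decide), a.2 (by decide), a.2 (by decide)⟩

/-- The map underlying the super-symplectic superinvolution on `UT_4(F)`. -/
def superSymplecticMap : UT F 4 →ₗ[F] UT F 4 where
  toFun M := ⟨superSymplecticMatrix F M.1, by
    intro k j h
    fin_cases k <;> fin_cases j <;> first | rfl | (exfalso; revert h; decide)⟩
  map_add' M N := by
    apply Subtype.ext
    ext k j
    fin_cases k <;> fin_cases j <;> simp [superSymplecticMatrix]
    ring
  map_smul' c M := by
    apply Subtype.ext
    ext k j
    fin_cases k <;> fin_cases j <;> simp [superSymplecticMatrix]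

set_option linter.unusedSimpArgs false in
/-- The super-symplectic superinvolution on `UT_4(F)` with the grading `(0, 1, 0, 1)`. -/
noncomputable def superSymplectic : Superinvolution (grading0101 F) where
  toLinearMap := superSymplecticMap F
  map_mem := by
    intro i a ha k j h
    change superSymplecticMatrix F a.1 k j = 0
    rcases zmod_two_cases i with rfl | rfl
    · rw [grading0101.even_form F ha]
      fin_cases k <;> fin_cases j <;> first
        | rfl
        | exact neg_zero
        | exact absurd (by decide) h
    · rw [grading0101.odd_form F ha]
      fin_cases k <;> fin_cases j <;> first
        | rfl
        | exact absurd (by decide) h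
  involutive := by
    intro a
    have H : ∀ k j : Fin 4, j < k → a.1 k j = 0 := fun k j h => a.2 h
    apply Subtype.ext
    ext k j
    fin_cases k <;> fin_cases j <;> first
      | rfl
      | exact neg_neg _
      | exact (H _ _ (by decide)).symm
  map_mul := by
    intro i j a b ha hb
    apply Subtype.ext
    change superSymplecticMatrix F (a.1 * b.1) = (-1 : F) ^ (i.val * j.val) •
      (superSymplecticMatrix F b.1 * superSymplecticMatrix F a.1)
    rw [← Matrix.ext_iff]
    obtain ⟨t0, t1, t2, t3, t4, t5⟩ := UT.lower_zero F a
    obtain ⟨u0, u1, u2, u3, u4, u5⟩ := UT.lower_zero F b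
    rcases zmod_two_cases i with rfl | rfl <;> rcases zmod_two_cases j with rfl | rfl
    · obtain ⟨p0, p1, p2, p3⟩ := grading0101.even_zero F ha
      obtain ⟨q0, q1, q2, q3⟩ := grading0101.even_zero F hb
      simp only [ZMod.val_zero, ZMod.val_one, mul_zero, zero_mul, mul_one, pow_zero, pow_one]
      refine forall_fin_four ?_ ?_ ?_ ?_ <;> refine forall_fin_four ?_ ?_ ?_ ?_ <;>
        simp only [Matrix.smul_apply, smul_eq_mul, superSymplecticMatrix.entries, mul_apply_four,
          t0, t1, t2, t3, t4, t5,
          u0, u1, u2, u3, u4, u5,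
          p0, p1, p2, p3, q0, q1, q2, q3,
          mul_zero, zero_mul, add_zero, zero_add, neg_zero] <;> ring
    · obtain ⟨p0, p1, p2, p3⟩ := grading0101.even_zero F ha
      obtain ⟨q0, q1, q2, q3, q4, q5⟩ := grading0101.odd_zero F hb
      simp only [ZMod.val_zero, ZMod.val_one, mul_zero, zero_mul, mul_one, pow_zero, pow_one]
      refine forall_fin_four ?_ ?_ ?_ ?_ <;> refine forall_fin_four ?_ ?_ ?_ ?_ <;>
        simp only [Matrix.smul_apply, smul_eq_mul, superSymplecticMatrix.entries, mul_apply_four,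
          t0, t1, t2, t3, t4, t5,
          u0, u1, u2, u3, u4, u5,
          p0, p1, p2, p3, q0, q1, q2, q3, q4, q5,
          mul_zero, zero_mul, add_zero, zero_add, neg_zero] <;> ring
    · obtain ⟨p0, p1, p2, p3, p4, p5⟩ := grading0101.odd_zero F ha
      obtain ⟨q0, q1, q2, q3⟩ := grading0101.even_zero F hb
      simp only [ZMod.val_zero, ZMod.val_one, mul_zero, zero_mul, mul_one, pow_zero, pow_one]
      refine forall_fin_four ?_ ?_ ?_ ?_ <;> refine forall_fin_four ?_ ?_ ?_ ?_ <;>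
        simp only [Matrix.smul_apply, smul_eq_mul, superSymplecticMatrix.entries, mul_apply_four,
          t0, t1, t2, t3, t4, t5,
          u0, u1, u2, u3, u4, u5,
          p0, p1, p2, p3, p4, p5, q0, q1, q2, q3,
          mul_zero, zero_mul, add_zero, zero_add, neg_zero] <;> ring
    · obtain ⟨p0, p1, p2, p3, p4, p5⟩ := grading0101.odd_zero F ha
      obtain ⟨q0, q1, q2, q3, q4, q5⟩ := grading0101.odd_zero F hb
      simp only [ZMod.val_zero, ZMod.val_one, mul_zero, zero_mul, mul_one, pow_zero, pow_one]
      refine forall_fin_four ?_ ?_ ?_ ?_ <;> refine forall_fin_four ?_ ?_ ?_ ?_ <;>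
        simp only [Matrix.smul_apply, smul_eq_mul, superSymplecticMatrix.entries, mul_apply_four,
          t0, t1, t2, t3, t4, t5,
          u0, u1, u2, u3, u4, u5,
          p0, p1, p2, p3, p4, p5, q0, q1, q2, q3, q4, q5,
          mul_zero, zero_mul, add_zero, zero_add, neg_zero] <;> ring

end UpperTriangular

end SuperStar

/-!
An identity holds if and only if each of its components with a fixed choice `w` of the kinds of the
variables holds, so the codimension is the sum over `w` of the rank of the monomials of kinds `w`
(`codimension_eq_sum`). By duality this rank is the dimension of `evalSpace F w`, the space of
functions on words spanned by the entries of the values of the words under all substitutions.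

A product of even matrices is determined by the products `A`, `B` of the diagonal parameters, the
product of the signs and the two corner entries in positions `(1, 3)` and `(2, 4)`. A corner entry
is a sum over the letters in which the summand of a letter depends only on this letter and on the
set of letters on one side of it, that is, a sum of weights along a maximal chain of subsets
(`chainSum`). Multiplying out words `l₀ x l₁ y ⋯` with even segments `l₀, l₁, …` and odd letters
`x, y, …` describes `evalSpace F w` explicitly; choosing `A` and `B` as indicators of a set of
letters shows that every function of the described form occurs. With `m` even letters and `s` odd
skew letters out of `n` letters:

* no odd letter: sums of weights along maximal chains of subsets of all letters. The relations are
  the coboundaries of functions that vanish on `∅` and on the whole set (`exists_potential`), and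
  the rank is `n 2^(n-1) - (2^n - 2)`.
* one odd letter: up to sign, a function of the set of letters of `l₀`, plus sums of one system of
  weights along the chains that grow from the odd letter to the left and to the right. Relations are
  given by potentials that vanish on `∅`, and the rank is `2^m + m 2^(m-1) - (2^m - 1)`.
* two odd letters, in each of the two orders: up to sign, a function of `l₀` if the second is skew,
  plus a function of `l₂` if the first is skew. The only relations are the constants in case both
  are skew, and the rank is `2 s 2^m`, diminished by `2` if `s = 2`.
* three odd letters: a function of the middle one, which has to be skew, and of the set of even
  letters between the outer ones. The rank is `s 2^m`.
* four odd letters or more give zero, since odd matrices are strictly upper triangular.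

The summation over `w` gives the formula for the codimension `c n`, and
`4^n ≤ c n ≤ n^3 4^n` for `n ≥ 3` gives the exponent.
-/

namespace SuperStar

/-! ### Chains of subsets -/

section Chains

variable {ι F : Type*} [DecidableEq ι] [Field F]

/-- The sum of the weights `wt i S` over the edges `S ⋖ S ∪ {i}` of the maximal chain of subsets
that is obtained by adding the entries of a list one by one, the last entry first. -/
def chainSum (wt : ι → Finset ι → F) : List ι → F
  | [] => 0
  | i :: l => wt i l.toFinset + chainSum wt l

theorem chainSum_append (wt : ι → Finset ι → F) {l l' : List ι} (h : l.toFinset = l'.toFinset)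
    (r : List ι) :
    chainSum wt (r ++ l) - chainSum wt l = chainSum wt (r ++ l') - chainSum wt l' := by
  induction r with
  | nil => simp
  | cons i r ih =>
    simp only [List.cons_append, chainSum, List.toFinset_append, h]
    linear_combination ih

theorem chainSum_congr {wt wt' : ι → Finset ι → F} {X : Finset ι}
    (h : ∀ i ∈ X, ∀ S ⊆ X.erase i, wt i S = wt' i S) {l : List ι} (hl : l.Nodup)
    (hX : l.toFinset ⊆ X) : chainSum wt l = chainSum wt' l := by
  induction l with
  | nil => rfl
  | cons i l ih =>
    simp only [List.nodup_cons] at hl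
    simp only [List.toFinset_cons, Finset.insert_subset_iff] at hX
    rw [chainSum, chainSum, ih hl.2 hX.2, h i hX.1]
    rw [Finset.subset_erase]
    exact ⟨hX.2, by simpa using hl.1⟩

theorem chainSum_coboundary (h : Finset ι → F) (l : List ι) :
    chainSum (fun i S => h (insert i S) - h S) l = h l.toFinset - h ∅ := by
  induction l with
  | nil => simp [chainSum]
  | cons i l ih => rw [chainSum, ih, List.toFinset_cons]; ring

/-- Weights with the same sum along every maximal chain from `∅` to `X` have a potential:
they are the differences of a function on the vertices. -/
theorem exists_potential {wt : ι → Finset ι → F} {X : Finset ι} {C : F}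
    (hC : ∀ l : List ι, l.Nodup → l.toFinset = X → chainSum wt l = C) :
    ∃ h : Finset ι → F, h ∅ = 0 ∧ h X = C ∧
      ∀ i ∈ X, ∀ S ⊆ X.erase i, wt i S = h (insert i S) - h S := by
  refine ⟨fun S => chainSum wt S.toList, by simp [chainSum],
    hC _ (Finset.nodup_toList _) (Finset.toList_toFinset _), ?_⟩
  intro i hi S hS
  rw [Finset.subset_erase] at hS
  obtain ⟨hS, hiS⟩ := hS
  have hsub : insert i S ⊆ X := Finset.insert_subset hi hS
  -- complete both chains from `∅` to `insert i S` to maximal chains in the same way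
  have hr : ∀ l : List ι, l.Nodup → l.toFinset = insert i S →
      chainSum wt ((X \ insert i S).toList ++ l) = C := by
    intro l hl hlS
    apply hC
    · rw [List.nodup_append]
      refine ⟨Finset.nodup_toList _, hl, ?_⟩
      rintro a ha b hb rfl
      rw [Finset.mem_toList, Finset.mem_sdiff, ← hlS, List.mem_toFinset] at ha
      exact ha.2 hb
    · rw [List.toFinset_append, hlS, Finset.toList_toFinset, Finset.sdiff_union_of_subset hsub]
  have h1 : (insert i S).toList.toFinset = insert i S := Finset.toList_toFinset _
  have h2 : (i :: S.toList).toFinset = insert i S := by simp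
  have e1 := hr _ (Finset.nodup_toList _) h1
  have e2 := hr (i :: S.toList) (by simpa using ⟨hiS, Finset.nodup_toList S⟩) h2
  have e3 := chainSum_append wt (h1.trans h2.symm) (X \ insert i S).toList
  rw [e1, e2] at e3
  simp only [chainSum, Finset.toList_toFinset] at e3
  linear_combination e3

/-- The edges `S ⋖ S ∪ {i}` of the lattice of subsets of `X`, as the pairs `⟨i, S⟩`. -/
def edges (X : Finset ι) : Finset (Σ _ : ι, Finset ι) :=
  X.sigma fun i => (X.erase i).powerset

theorem card_edges (X : Finset ι) : (edges X).card = X.card * 2 ^ (X.card - 1) := by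
  rw [edges, Finset.card_sigma, Finset.sum_congr rfl fun i hi => by
    rw [Finset.card_powerset, Finset.card_erase_of_mem hi], Finset.sum_const, smul_eq_mul]

theorem mem_edges {X : Finset ι} {i : ι} {S : Finset ι} :
    (⟨i, S⟩ : Σ _ : ι, Finset ι) ∈ edges X ↔ i ∈ X ∧ S ⊆ X.erase i := by
  simp [edges]

variable (F) in
/-- The extension by zero of functions on a finset. -/
noncomputable def extendZero {α : Type*} (s : Finset α) : (s → F) →ₗ[F] (α → F) :=
  Function.ExtendByZero.linearMap F (Subtype.val : s → α)

theorem extendZero_mem {α : Type*} {s : Finset α} (f : s → F) {x : α} (hx : x ∈ s) :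
    extendZero F s f x = f ⟨x, hx⟩ :=
  Subtype.val_injective.extend_apply f 0 (⟨x, hx⟩ : s)

theorem extendZero_notMem {α : Type*} {s : Finset α} (f : s → F) {x : α} (hx : x ∉ s) :
    extendZero F s f x = 0 := by
  change Function.extend _ _ _ _ = _
  rw [Function.extend_apply']
  · rfl
  · rintro ⟨a, rfl⟩
    exact hx a.2

theorem extendZero_restrict {α : Type*} {s : Finset α} (f : α → F) {x : α}
    (hx : x ∉ s → f x = 0) : extendZero F s (fun y : s => f y) x = f x := by
  by_cases h : x ∈ s
  · rw [extendZero_mem _ h]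
  · rw [extendZero_notMem _ h, hx h]

variable (F) in
/-- The map that sends weights on the edges of the lattice of subsets of `X` to the function
`chainSum` on lists. -/
noncomputable def chainSumₗ (X : Finset ι) : (edges X → F) →ₗ[F] (List ι → F) where
  toFun wt l := chainSum (fun i S => extendZero F (edges X) wt ⟨i, S⟩) l
  map_add' a b := by
    ext l
    induction l with
    | nil => simp [chainSum]
    | cons i l ih =>
      simp only [Pi.add_apply, map_add, chainSum] at ih ⊢
      rw [ih]; ring
  map_smul' a b := by
    ext l
    induction l with
    | nil => simp [chainSum]
    | cons i l ih =>
      simp only [Pi.smul_apply, map_smul, chainSum, RingHom.id_apply, smul_eq_mul] at ih ⊢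
      rw [ih]; ring

theorem chainSumₗ_restrict {X : Finset ι} (wt : ι → Finset ι → F) {l : List ι} (hl : l.Nodup)
    (hX : l.toFinset ⊆ X) :
    chainSumₗ F X (fun e => wt e.1.1 e.1.2) l = chainSum wt l := by
  refine chainSum_congr (X := X) ?_ hl hX
  intro i hi S hS
  exact extendZero_mem (s := edges X) _ (mem_edges.2 ⟨hi, hS⟩)

variable (F) in
/-- The coboundary of the functions on a set `V` of vertices of the lattice of subsets of `X`,
extended by zero to the other vertices. -/
noncomputable def coboundary (X : Finset ι) (V : Finset (Finset ι)) :
    (V → F) →ₗ[F] (edges X → F) where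
  toFun h e := extendZero F V h (insert e.1.1 e.1.2) - extendZero F V h e.1.2
  map_add' a b := by ext; simp; ring
  map_smul' a b := by ext; simp; ring

theorem chainSumₗ_coboundary {X : Finset ι} {V : Finset (Finset ι)} (hV : ∅ ∉ V) (h : V → F)
    {l : List ι} (hl : l.Nodup) (hX : l.toFinset ⊆ X) :
    chainSumₗ F X (coboundary F X V h) l = extendZero F V h l.toFinset := by
  have := chainSumₗ_restrict (F := F) (X := X)
    (fun i S => extendZero F V h (insert i S) - extendZero F V h S) hl hX
  rw [chainSum_coboundary, extendZero_notMem (x := ∅) _ hV, sub_zero] at this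
  exact this

theorem coboundary_injective {X : Finset ι} {V : Finset (Finset ι)} (hV : ∅ ∉ V)
    (hVX : ∀ S ∈ V, S ⊆ X) : Function.Injective (coboundary F X V) := by
  rw [injective_iff_map_eq_zero]
  intro h hh
  ext ⟨S, hS⟩
  have := chainSumₗ_coboundary hV h (l := S.toList) (X := X) (Finset.nodup_toList S)
    (by simpa using hVX S hS)
  rw [hh, map_zero, Finset.toList_toFinset, extendZero_mem _ hS] at this
  exact this.symm

theorem eq_coboundary {X : Finset ι} {V : Finset (Finset ι)} {wt : edges X → F}
    {h : Finset ι → F} (hV : ∀ S ⊆ X, S ∉ V → h S = 0)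
    (hh : ∀ i ∈ X, ∀ S ⊆ X.erase i,
      extendZero F (edges X) wt ⟨i, S⟩ = h (insert i S) - h S) :
    coboundary F X V (fun S => h S) = wt := by
  ext ⟨⟨i, S⟩, he⟩
  obtain ⟨hi, hS⟩ := mem_edges.1 he
  have hSX := hS.trans (Finset.erase_subset _ _)
  have := hh i hi S hS
  rw [extendZero_mem _ he] at this
  rw [this]
  change extendZero F V (fun S : V => h S) (insert i S) - extendZero F V (fun S : V => h S) S = _
  rw [extendZero_restrict _ (hV _ (Finset.insert_subset hi hSX)), extendZero_restrict _ (hV _ hSX)]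

/-- The rank of `g` when its relations are parametrized by `f`. -/
theorem finrank_range_add_of_exact {U V W : Type*} [AddCommGroup U] [Module F U]
    [AddCommGroup V] [Module F V] [AddCommGroup W] [Module F W] [FiniteDimensional F W]
    {f : V →ₗ[F] W} {g : W →ₗ[F] U} (hf : Function.Injective f)
    (hfg : LinearMap.range f = LinearMap.ker g) :
    Module.finrank F (LinearMap.range g) + Module.finrank F V = Module.finrank F W := by
  rw [← LinearMap.finrank_range_add_finrank_ker g, ← hfg, LinearMap.finrank_range_of_inj hf]

end Chains

/-! ### Codimensions and multihomogeneous components -/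

section Evaluation

variable {F : Type*} [Field F]

instance : DecidableEq VarKind := fun a b => by
  cases a <;> cases b <;> first | exact isTrue rfl | exact isFalse (by simp)

instance : Fintype VarKind where
  elems := {.evenSymm, .evenSkew, .oddSymm, .oddSkew}
  complete k := by cases k <;> decide

/-- The general element of the component of `UT_4(F)` of the given kind. The parameter `c` is
not used in the odd components, which have dimension two. -/
def gen (k : VarKind) (a b c : F) : Matrix (Fin 4) (Fin 4) F :=
  match k with
  | .evenSymm => !![a, 0, c, 0; 0, b, 0, c; 0, 0, b, 0; 0, 0, 0, a]
  | .evenSkew => !![a, 0, c, 0; 0, b, 0, -c; 0, 0, -b, 0; 0, 0, 0, -a]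
  | .oddSymm => !![0, a, 0, b; 0, 0, 0, 0; 0, 0, 0, a; 0, 0, 0, 0]
  | .oddSkew => !![0, a, 0, 0; 0, 0, b, 0; 0, 0, 0, -a; 0, 0, 0, 0]

theorem gen_mem (k : VarKind) (a b c : F) : gen k a b c ∈ UT F 4 := by
  intro i j h
  cases k <;> fin_cases i <;> fin_cases j <;> first | rfl | (exfalso; revert h; decide)

theorem mem_part_iff [CharZero F] (k : VarKind) (x : UT F 4) :
    x ∈ (superSymplectic F).part k ↔ ∃ a b c, x.1 = gen k a b c := by
  have hU : ∀ (ε : ℤˣ), (superSymplecticMap F x = ε • x) ↔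
      superSymplecticMatrix F x.1 = (ε : ℤ) • x.1 := by
    intro ε
    rw [Subtype.ext_iff]
    rfl
  change (x ∈ elementaryGrading F ![0, 1, 0, 1] k.degree ∧
    superSymplecticMap F x = k.sign • x) ↔ _
  rw [hU]
  constructor
  · rintro ⟨hx, h⟩
    have e := fun i j => congrFun (congrFun h i) j
    cases k
    · have f := grading0101.even_form F hx
      refine ⟨x.1 0 0, x.1 1 1, x.1 0 2, ?_⟩
      have e0 := e 0 0; have e1 := e 1 1; have e2 := e 0 2
      simp [superSymplecticMatrix, VarKind.sign] at e0 e1 e2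
      rw [f]; simp [gen, e0, e1, e2]
    · have f := grading0101.even_form F hx
      refine ⟨x.1 0 0, x.1 1 1, x.1 0 2, ?_⟩
      have e0 := e 0 0; have e1 := e 1 1; have e2 := e 0 2
      simp [superSymplecticMatrix, VarKind.sign] at e0 e1 e2
      rw [f]; simp [gen, e0, e1, e2]
    · have f := grading0101.odd_form F hx
      refine ⟨x.1 0 1, x.1 0 3, 0, ?_⟩
      have e0 := e 0 1; have e1 := e 1 2
      simp [superSymplecticMatrix, VarKind.sign, neg_eq_self] at e0 e1
      rw [f]; simp [gen, e0, e1]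
    · have f := grading0101.odd_form F hx
      refine ⟨x.1 0 1, x.1 1 2, 0, ?_⟩
      have e0 := e 0 1; have e1 := e 0 3
      simp [superSymplecticMatrix, VarKind.sign, self_eq_neg] at e0 e1
      rw [f]; simp [gen, e0, e1]
  · rintro ⟨a, b, c, h⟩
    constructor
    · intro i j hij
      rw [h]
      cases k <;> fin_cases i <;> fin_cases j <;> first | rfl | exact absurd (by decide) hij
    · rw [h]
      ext i j
      cases k <;> fin_cases i <;> fin_cases j <;> simp [gen, superSymplecticMatrix, VarKind.sign]

variable {n : ℕ}

/-- The value of the word `l` in the variables of kinds `w` under the substitution of general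
elements with the parameters `a`, `b`, `c`. -/
def value (w : Fin n → VarKind) (a b c : Fin n → F) (l : List (Fin n)) :
    Matrix (Fin 4) (Fin 4) F :=
  (l.map fun i => gen (w i) (a i) (b i) (c i)).prod

variable (F) in
/-- The space spanned by the functions that send a permutation `σ` to an entry of the value of
the monomial `w_{σ(1)} ⋯ w_{σ(n)}` under a fixed substitution. -/
def evalSpace (w : Fin n → VarKind) : Submodule F (Equiv.Perm (Fin n) → F) :=
  Submodule.span F {f | ∃ (a b c : Fin n → F) (i j : Fin 4),
    f = fun σ : Equiv.Perm (Fin n) => value w a b c (List.ofFn σ) i j}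

/-- The annihilator of a space of functions on a finite set with respect to the dot product. -/
def dotAnnihilator {α : Type*} [Fintype α] (V : Submodule F (α → F)) : Submodule F (α → F) where
  carrier := {x | ∀ f ∈ V, ∑ s, x s * f s = 0}
  zero_mem' := by simp
  add_mem' {x y} hx hy f hf := by
    simp only [Pi.add_apply, add_mul, Finset.sum_add_distrib, hx f hf, hy f hf, add_zero]
  smul_mem' c x hx f hf := by
    simp only [Pi.smul_apply, smul_eq_mul, mul_assoc, ← Finset.mul_sum, hx f hf, mul_zero]

theorem finrank_quotient_dotAnnihilator {α : Type*} [Fintype α] (V : Submodule F (α → F)) :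
    Module.finrank F ((α → F) ⧸ dotAnnihilator V) = Module.finrank F V := by
  classical
  let T : (α → F) →ₗ[F] Module.Dual F V :=
    { toFun := fun x => (Fintype.linearCombination F x).comp V.subtype
      map_add' := fun x y => by
        ext f; simp [Fintype.linearCombination_apply, mul_add, Finset.sum_add_distrib]
      map_smul' := fun c x => by
        ext f
        simp only [LinearMap.comp_apply, Fintype.linearCombination_apply, Pi.smul_apply,
          smul_eq_mul, LinearMap.smul_apply, RingHom.id_apply, Finset.mul_sum]
        exact Finset.sum_congr rfl fun _ _ => by ring }
  have hT : ∀ x f, T x f = ∑ s, x s * f.1 s := by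
    intro x f
    change Fintype.linearCombination F x f.1 = _
    rw [Fintype.linearCombination_apply]
    exact Finset.sum_congr rfl fun _ _ => mul_comm _ _
  have hker : LinearMap.ker T = dotAnnihilator V := by
    ext x
    rw [LinearMap.mem_ker]
    constructor
    · intro h f hf
      rw [← hT x ⟨f, hf⟩, h]; rfl
    · intro h
      ext f
      rw [hT]; exact h f.1 f.2
  have hsurj : Function.Surjective T := by
    intro φ
    obtain ⟨ψ, hψ⟩ := φ.exists_extend
    refine ⟨fun s => ψ (Pi.single s 1), ?_⟩
    ext f
    rw [hT, ← hψ]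
    change _ = ψ f.1
    conv_rhs => rw [pi_eq_sum_univ' f.1, map_sum]
    refine Finset.sum_congr rfl fun s _ => ?_
    rw [map_smul, smul_eq_mul, mul_comm]
  rw [← hker, (T.quotKerEquivOfSurjective hsurj).finrank_eq, Subspace.dual_finrank_eq]

/-- The value of a monomial as an element of `UT_4(F)`. -/
theorem coe_lift_word (w : Fin n → VarKind) (u : VarKind × ℕ → UT F 4) (a b c : Fin n → F)
    (hu : ∀ i, (u (w i, i)).1 = gen (w i) (a i) (b i) (c i)) (σ : Equiv.Perm (Fin n)) :
    (FreeAlgebra.lift F u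
      (List.ofFn fun i : Fin n => FreeAlgebra.ι F (w (σ i), (σ i : ℕ))).prod).1 =
        value w a b c (List.ofFn σ) := by
  change (UT F 4).val _ = _
  rw [map_list_prod, map_list_prod, List.map_ofFn, List.map_ofFn, value, List.map_ofFn]
  congr 2
  ext1 i
  simp only [Function.comp_apply, FreeAlgebra.lift_ι_apply]
  exact hu (σ i)

theorem lift_word_eq_zero {w : Fin n → VarKind} {u : VarKind × ℕ → UT F 4} {i : Fin n}
    (hu : u (w i, i) = 0) (σ : Equiv.Perm (Fin n)) :
    FreeAlgebra.lift F u
      (List.ofFn fun i : Fin n => FreeAlgebra.ι F (w (σ i), (σ i : ℕ))).prod = 0 := by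
  rw [map_list_prod]
  refine List.prod_eq_zero ?_
  rw [List.map_ofFn, List.mem_ofFn]
  exact ⟨σ.symm i, by simp [hu]⟩

/-- A multilinear polynomial, given by its coefficients, is an identity if and only if for each
choice `w` of kinds its coefficients annihilate `evalSpace w`. -/
theorem sum_mem_identities_iff [CharZero F]
    (x : (Fin n → VarKind) → Equiv.Perm (Fin n) → F) :
    ∑ w, ∑ σ : Equiv.Perm (Fin n), x w σ •
      (List.ofFn fun i : Fin n => FreeAlgebra.ι F (w (σ i), (σ i : ℕ))).prod ∈
        (superSymplectic F).identities ↔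
    ∀ w, x w ∈ dotAnnihilator (evalSpace F w) := by
  constructor
  · intro h w f hf
    rw [evalSpace] at hf
    induction hf using Submodule.span_induction with
    | zero => simp
    | add f g _ _ hf hg =>
      simp only [Pi.add_apply, mul_add, Finset.sum_add_distrib, hf, hg, add_zero]
    | smul t f _ hf =>
      simp only [Pi.smul_apply, smul_eq_mul, mul_left_comm _ t, ← Finset.mul_sum, hf, mul_zero]
    | mem f hf =>
      obtain ⟨a, b, c, i, j, rfl⟩ := hf
      -- substitute zero for the variables that do not occur in the monomials of kinds `w`
      let u : VarKind × ℕ → UT F 4 := fun p =>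
        if hp : p.2 < n then
          if p.1 = w ⟨p.2, hp⟩ then
            ⟨gen p.1 (a ⟨p.2, hp⟩) (b ⟨p.2, hp⟩) (c ⟨p.2, hp⟩), gen_mem _ _ _ _⟩
          else 0
        else 0
      have hu1 : ∀ i : Fin n, (u (w i, i)).1 = gen (w i) (a i) (b i) (c i) := by
        intro i; simp [u]
      have hu2 : ∀ (k : VarKind) (i : Fin n), k ≠ w i → u (k, i) = 0 := by
        intro k i hk; simp [u, hk]
      have h0 := h u (by
        intro k i
        by_cases hi : i < n
        · by_cases hk : k = w ⟨i, hi⟩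
          · rw [mem_part_iff]
            exact ⟨a ⟨i, hi⟩, b ⟨i, hi⟩, c ⟨i, hi⟩, by simp [u, hi, hk]⟩
          · simp [u, hi, hk]
        · simp [u, hi])
      rw [map_sum, Finset.sum_eq_single w] at h0
      · rw [map_sum] at h0
        have h1 := congrArg (fun M : UT F 4 => M.1 i j) h0
        simp only [map_smul] at h1
        change (UT F 4).val _ i j = 0 at h1
        rw [map_sum, Matrix.sum_apply] at h1
        rw [← h1]
        refine Finset.sum_congr rfl fun σ _ => ?_
        change _ * value w a b c (List.ofFn σ) i j = _
        rw [← coe_lift_word w u a b c hu1 σ]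
        rfl
      · intro w' _ hw'
        obtain ⟨i, hi⟩ := Function.ne_iff.1 hw'
        rw [map_sum]
        refine Finset.sum_eq_zero fun σ _ => ?_
        rw [map_smul, lift_word_eq_zero (hu2 _ _ hi), smul_zero]
      · simp
  · intro h u hu
    rw [map_sum]
    refine Finset.sum_eq_zero fun w _ => ?_
    have hex : ∀ i : Fin n, ∃ a b c, (u (w i, i)).1 = gen (w i) a b c :=
      fun i => (mem_part_iff _ _).1 (hu _ _)
    choose a b c habc using hex
    rw [map_sum]
    apply Subtype.ext
    ext i j
    change (UT F 4).val _ i j = 0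
    rw [map_sum, Matrix.sum_apply]
    rw [← h w _ (Submodule.subset_span ⟨a, b, c, i, j, rfl⟩)]
    refine Finset.sum_congr rfl fun σ _ => ?_
    rw [← coe_lift_word w u a b c habc σ, map_smul]
    rfl

/-- The codimension is the sum of the ranks of the multihomogeneous components. -/
theorem codimension_eq_sum [CharZero F] (n : ℕ) :
    (superSymplectic F).codimension n =
      ∑ w : Fin n → VarKind, Module.finrank F (evalSpace F w) := by
  let Ψ₀ : ((Fin n → VarKind) → Equiv.Perm (Fin n) → F) →ₗ[F] FreeStarAlgebra F :=
    { toFun := fun x => ∑ w, ∑ σ : Equiv.Perm (Fin n), x w σ •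
        (List.ofFn fun i : Fin n => FreeAlgebra.ι F (w (σ i), (σ i : ℕ))).prod
      map_add' := fun x y => by simp only [Pi.add_apply, add_smul, Finset.sum_add_distrib]
      map_smul' := fun c x => by
        simp only [Pi.smul_apply, smul_assoc, ← Finset.smul_sum, RingHom.id_apply] }
  have hmem : ∀ x, Ψ₀ x ∈ multilinearPolynomials F n := fun x =>
    Submodule.sum_mem _ fun w _ => Submodule.sum_mem _ fun σ _ =>
      Submodule.smul_mem _ _ (Submodule.subset_span ⟨σ, w, rfl⟩)
  let Ψ := Ψ₀.codRestrict (multilinearPolynomials F n) hmem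
  have hsurj : Function.Surjective Ψ := by
    rintro ⟨f, hf⟩
    have : f ∈ LinearMap.range Ψ₀ := by
      refine Submodule.span_le.2 ?_ hf
      rintro _ ⟨σ, w, rfl⟩
      refine ⟨Pi.single w (Pi.single σ 1), ?_⟩
      change ∑ w', ∑ σ' : Equiv.Perm (Fin n), _ = _
      rw [Finset.sum_eq_single w, Finset.sum_eq_single σ]
      · simp
      · intro τ _ hτ; simp [hτ]
      · simp
      · intro w' _ hw'; simp [hw']
      · simp
    obtain ⟨x, hx⟩ := this
    exact ⟨x, Subtype.ext hx⟩
  let q := (superSymplectic F).identities.submoduleOf (multilinearPolynomials F n)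
  have hker : LinearMap.ker (q.mkQ.comp Ψ) =
      Submodule.pi Set.univ fun w => dotAnnihilator (evalSpace F w) := by
    ext x
    rw [LinearMap.mem_ker, LinearMap.comp_apply, Submodule.mkQ_apply,
      Submodule.Quotient.mk_eq_zero, Submodule.mem_pi]
    simp only [Set.mem_univ, forall_true_left]
    rw [← sum_mem_identities_iff]
    rfl
  have e1 := ((q.mkQ.comp Ψ).quotKerEquivOfSurjective
    (q.mkQ_surjective.comp hsurj)).finrank_eq
  rw [hker] at e1
  change Module.finrank F (multilinearPolynomials F n ⧸ q) = _
  rw [← e1, (Submodule.quotientPi _).finrank_eq, Module.finrank_pi_fintype]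
  exact Finset.sum_congr rfl fun w _ => finrank_quotient_dotAnnihilator _

end Evaluation

/-! ### Products of even and odd matrices -/

section Products

variable {F : Type*} [Field F]

/-- The kinds of odd degree. -/
def VarKind.isOdd : VarKind → Bool
  | evenSymm => false
  | evenSkew => false
  | oddSymm => true
  | oddSkew => true

/-- The kinds of skew variables. -/
def VarKind.isSkew : VarKind → Bool
  | evenSymm => false
  | evenSkew => true
  | oddSymm => false
  | oddSkew => true

variable (F) in
/-- The sign of a kind, as a scalar. -/
def VarKind.eps (k : VarKind) : F := if k.isSkew then -1 else 1

theorem VarKind.eps_mul_self (k : VarKind) : k.eps F * k.eps F = 1 := by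
  cases k <;> simp [eps, isSkew]

theorem VarKind.eps_ne_zero (k : VarKind) : k.eps F ≠ 0 :=
  left_ne_zero_of_mul (by rw [k.eps_mul_self]; exact one_ne_zero)

/-- The shape of a product of even matrices: the sign `e` relates the last two diagonal entries
to the first two. -/
def evenMat (A B C D e : F) : Matrix (Fin 4) (Fin 4) F :=
  !![A, 0, C, 0; 0, B, 0, D; 0, 0, e * B, 0; 0, 0, 0, e * A]

/-- The shape of a general odd matrix. -/
def oddMat (x y z t : F) : Matrix (Fin 4) (Fin 4) F :=
  !![0, x, 0, t; 0, 0, y, 0; 0, 0, 0, z; 0, 0, 0, 0]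

theorem gen_even {k : VarKind} (hk : k.isOdd = false) (a b c : F) :
    gen k a b c = evenMat a b c (k.eps F * c) (k.eps F) := by
  cases k <;> simp [gen, evenMat, VarKind.eps, VarKind.isOdd, VarKind.isSkew] at hk ⊢

theorem gen_odd {k : VarKind} (hk : k.isOdd = true) (a b c : F) :
    gen k a b c = oddMat a (if k.isSkew then b else 0) (k.eps F * a)
      (if k.isSkew then 0 else b) := by
  cases k <;> simp [gen, oddMat, VarKind.eps, VarKind.isOdd, VarKind.isSkew] at hk ⊢

theorem evenMat_mul_evenMat (A B C D e A' B' C' D' e' : F) :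
    evenMat A B C D e * evenMat A' B' C' D' e' =
      evenMat (A * A') (B * B') (A * C' + C * (e' * B')) (B * D' + D * (e' * A')) (e * e') := by
  ext i j
  rw [mul_apply_four]
  fin_cases i <;> fin_cases j <;> simp [evenMat] <;> ring

theorem evenMat_mul_oddMat (A B C D e x y z t : F) :
    evenMat A B C D e * oddMat x y z t =
      oddMat (A * x) (B * y) (e * B * z) (A * t + C * z) := by
  ext i j
  rw [mul_apply_four]
  fin_cases i <;> fin_cases j <;> simp [evenMat, oddMat]

theorem oddMat_mul_evenMat (A B C D e x y z t : F) :
    oddMat x y z t * evenMat A B C D e =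
      oddMat (x * B) (y * (e * B)) (z * (e * A)) (x * D + t * (e * A)) := by
  ext i j
  rw [mul_apply_four]
  fin_cases i <;> fin_cases j <;> simp [evenMat, oddMat]

theorem oddMat_mul_oddMat (x y z t x' y' z' t' : F) :
    oddMat x y z t * oddMat x' y' z' t' = evenMat 0 0 (x * y') (y * z') 0 := by
  ext i j
  rw [mul_apply_four]
  fin_cases i <;> fin_cases j <;> simp [evenMat, oddMat]

variable {n : ℕ} (w : Fin n → VarKind)

variable (F) in
/-- The product of the signs of the letters of a word. -/
def sgn (l : List (Fin n)) : F := (l.map fun i => (w i).eps F).prod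

theorem sgn_append (l r : List (Fin n)) : sgn F w (l ++ r) = sgn F w l * sgn F w r := by
  simp [sgn]

theorem sgn_cons (i : Fin n) (r : List (Fin n)) :
    sgn F w (i :: r) = (w i).eps F * sgn F w r := by
  simp [sgn]

theorem sgn_mul_self (l : List (Fin n)) : sgn F w l * sgn F w l = 1 := by
  induction l with
  | nil => simp [sgn]
  | cons i l ih =>
    rw [sgn_cons]
    linear_combination (w i).eps F * (w i).eps F * ih + (w i).eps_mul_self (F := F)

theorem sgn_ne_zero (l : List (Fin n)) : sgn F w l ≠ 0 :=
  left_ne_zero_of_mul (by rw [sgn_mul_self]; exact one_ne_zero)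

/-- The entry in position `(1, 3)` of the product of the even matrices along a list; with `a` and
`b` exchanged and `c` multiplied by the sign, the entry in position `(2, 4)`. -/
def cornerSum (a b c : Fin n → F) : List (Fin n) → F
  | [] => 0
  | i :: l => a i * cornerSum a b c l + c i * (sgn F w l * (l.map b).prod)

theorem cornerSum_concat (a b c : Fin n → F) (l : List (Fin n)) (i : Fin n) :
    cornerSum w a b c (l ++ [i]) =
      cornerSum w a b c l * ((w i).eps F * b i) + (l.map a).prod * c i := by
  induction l with
  | nil => simp [cornerSum, sgn]
  | cons j l ih =>
    rw [List.cons_append, cornerSum, ih, cornerSum, sgn_append]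
    simp [sgn]
    ring

theorem value_cons (a b c : Fin n → F) (i : Fin n) (l : List (Fin n)) :
    value w a b c (i :: l) = gen (w i) (a i) (b i) (c i) * value w a b c l := by
  simp [value]

theorem value_append (a b c : Fin n → F) (l r : List (Fin n)) :
    value w a b c (l ++ r) = value w a b c l * value w a b c r := by
  simp [value]

theorem value_even (a b c : Fin n → F) {l : List (Fin n)} (hl : ∀ i ∈ l, (w i).isOdd = false) :
    value w a b c l = evenMat (l.map a).prod (l.map b).prod (cornerSum w a b c l)
      (cornerSum w b a (fun i => (w i).eps F * c i) l) (sgn F w l) := by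
  induction l with
  | nil =>
    ext i j
    fin_cases i <;> fin_cases j <;> simp [value, evenMat, cornerSum, sgn]
  | cons i l ih =>
    rw [List.forall_mem_cons] at hl
    rw [value_cons, ih hl.2, gen_even hl.1, evenMat_mul_evenMat]
    simp only [cornerSum, List.map_cons, List.prod_cons, sgn_cons]

theorem value_one_odd (a b c : Fin n → F) {l₀ l₁ : List (Fin n)} {x : Fin n}
    (h₀ : ∀ i ∈ l₀, (w i).isOdd = false) (h₁ : ∀ i ∈ l₁, (w i).isOdd = false)
    (hx : (w x).isOdd = true) :
    value w a b c (l₀ ++ x :: l₁) = oddMat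
      ((l₀.map a).prod * a x * (l₁.map b).prod)
      ((l₀.map b).prod * (if (w x).isSkew then b x else 0) * (sgn F w l₁ * (l₁.map b).prod))
      (sgn F w l₀ * (l₀.map b).prod * ((w x).eps F * a x) * (sgn F w l₁ * (l₁.map a).prod))
      ((l₀.map a).prod * a x * cornerSum w b a (fun i => (w i).eps F * c i) l₁ +
        ((l₀.map a).prod * (if (w x).isSkew then 0 else b x) +
          cornerSum w a b c l₀ * ((w x).eps F * a x)) * (sgn F w l₁ * (l₁.map a).prod)) := by
  rw [value_append, value_cons, ← mul_assoc, value_even w a b c h₀, value_even w a b c h₁,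
    gen_odd hx, evenMat_mul_oddMat, oddMat_mul_evenMat]

theorem value_two_odd (a b c : Fin n → F) {l₀ l₁ l₂ : List (Fin n)} {x y : Fin n}
    (h₀ : ∀ i ∈ l₀, (w i).isOdd = false) (h₁ : ∀ i ∈ l₁, (w i).isOdd = false)
    (h₂ : ∀ i ∈ l₂, (w i).isOdd = false)
    (hx : (w x).isOdd = true) (hy : (w y).isOdd = true) :
    value w a b c (l₀ ++ x :: (l₁ ++ y :: l₂)) = evenMat 0 0
      ((l₀.map a).prod * a x * (l₁.map b).prod * (if (w y).isSkew then b y else 0) *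
        (sgn F w l₂ * (l₂.map b).prod))
      ((l₀.map b).prod * (if (w x).isSkew then b x else 0) * (sgn F w l₁ * (l₁.map b).prod) *
        ((w y).eps F * a y) * (sgn F w l₂ * (l₂.map a).prod)) 0 := by
  rw [← List.cons_append, ← List.append_assoc, value_append, value_one_odd w a b c h₀ h₁ hx,
    value_cons, value_even w a b c h₂, gen_odd hy, oddMat_mul_evenMat, oddMat_mul_oddMat]
  congr 1 <;> ring

theorem value_three_odd (a b c : Fin n → F) {l₀ l₁ l₂ l₃ : List (Fin n)} {x y z : Fin n}
    (h₀ : ∀ i ∈ l₀, (w i).isOdd = false) (h₁ : ∀ i ∈ l₁, (w i).isOdd = false)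
    (h₂ : ∀ i ∈ l₂, (w i).isOdd = false) (h₃ : ∀ i ∈ l₃, (w i).isOdd = false)
    (hx : (w x).isOdd = true) (hy : (w y).isOdd = true) (hz : (w z).isOdd = true) :
    value w a b c (l₀ ++ x :: (l₁ ++ y :: (l₂ ++ z :: l₃))) = oddMat 0 0 0
      ((l₀.map a).prod * a x * (l₁.map b).prod * (if (w y).isSkew then b y else 0) *
        (sgn F w l₂ * (l₂.map b).prod) * ((w z).eps F * a z) *
        (sgn F w l₃ * (l₃.map a).prod)) := by
  have e : l₀ ++ x :: (l₁ ++ y :: (l₂ ++ z :: l₃)) =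
      (l₀ ++ x :: (l₁ ++ y :: l₂)) ++ z :: l₃ := by simp
  rw [e, value_append, value_two_odd w a b c h₀ h₁ h₂ hx hy, value_cons,
    value_even w a b c h₃, gen_odd hz, oddMat_mul_evenMat, evenMat_mul_oddMat]
  congr 1 <;> ring

/-- An odd variable raises the index by at least one, so that four of them give zero. -/
theorem value_eq_zero_of_lt (a b c : Fin n → F) (l : List (Fin n)) (i j : Fin 4)
    (h : (j : ℕ) < i + (l.filter fun s => (w s).isOdd).length) : value w a b c l i j = 0 := by
  induction l generalizing i with
  | nil =>
    have : i ≠ j := by rintro rfl; simp at h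
    simp [value, Matrix.one_apply_ne this]
  | cons s l ih =>
    rw [value_cons, Matrix.mul_apply]
    refine Finset.sum_eq_zero fun m _ => ?_
    by_cases hs : (w s).isOdd = true
    · rw [List.filter_cons, if_pos hs, List.length_cons] at h
      by_cases him : i < m
      · rw [ih m (by have : (i : ℕ) < m := him; omega), mul_zero]
      · rw [gen_odd hs]
        have : oddMat (a s) (if (w s).isSkew then b s else 0) ((w s).eps F * a s)
          (if (w s).isSkew then 0 else b s) i m = 0 := by
          revert him
          fin_cases i <;> fin_cases m <;> simp [oddMat]
        rw [this, zero_mul]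
    · rw [List.filter_cons, if_neg hs] at h
      by_cases him : i ≤ m
      · rw [ih m (by have : (i : ℕ) ≤ m := him; omega), mul_zero]
      · have h0 : gen (w s) (a s) (b s) (c s) i m = 0 := gen_mem _ _ _ _ (not_le.1 him)
        rw [h0, zero_mul]

/-- The corner entry of the product along `l`, multiplied by the parameters `a` of the remaining
letters of `X`, is the sum of weights along a chain: the summand of the letter `i` is determined by
`i` and by the set `S` of the letters to the right of `i`. -/
theorem chainSum_cornerSum (a b c : Fin n → F) {X : Finset (Fin n)} {l : List (Fin n)}
    (hl : l.Nodup) (hX : l.toFinset ⊆ X) :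
    (∏ i ∈ X \ l.toFinset, a i) * cornerSum w a b c l =
      chainSum (fun i S => c i * ((∏ j ∈ S, (w j).eps F) * ∏ j ∈ S, b j) *
        ∏ j ∈ (X \ S).erase i, a j) l := by
  induction l with
  | nil => simp [cornerSum, chainSum]
  | cons i l ih =>
    rw [List.nodup_cons] at hl
    rw [List.toFinset_cons, Finset.insert_subset_iff] at hX
    have h1 : i ∈ X \ l.toFinset := by simp [hX.1, hl.1]
    have h2 := Finset.mul_prod_erase _ a h1
    have e1 : sgn F w l = ∏ j ∈ l.toFinset, (w j).eps F := (List.prod_toFinset _ hl.2).symm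
    have e2 : (l.map b).prod = ∏ j ∈ l.toFinset, b j := (List.prod_toFinset _ hl.2).symm
    rw [chainSum, ← ih hl.2 hX.2, cornerSum, ← h2, List.toFinset_cons, Finset.sdiff_insert, e1, e2]
    ring

/-- In the corner entry in position `(2, 4)` the summand of the letter `i` is determined, up to
the sign of `l`, by the set of the letters to the left of `i`, with the same weights. -/
theorem chainSum_cornerSum_reverse (a b c : Fin n → F) {X : Finset (Fin n)} {l : List (Fin n)}
    (hl : l.Nodup) (hX : l.toFinset ⊆ X) :
    (∏ i ∈ X \ l.toFinset, a i) * cornerSum w b a (fun i => (w i).eps F * c i) l =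
      sgn F w l * chainSum (fun i S => c i * ((∏ j ∈ S, (w j).eps F) * ∏ j ∈ S, b j) *
        ∏ j ∈ (X \ S).erase i, a j) l.reverse := by
  induction l using List.reverseRecOn with
  | nil => simp [cornerSum, chainSum]
  | append_singleton l i ih =>
    have hl' : l.Nodup ∧ i ∉ l := by
      rw [List.nodup_append] at hl
      exact ⟨hl.1, fun h => hl.2.2 i h i (by simp) rfl⟩
    have hs : (l ++ [i]).toFinset = insert i l.toFinset := by
      rw [List.toFinset_append, Finset.union_comm]; rfl
    rw [hs, Finset.insert_subset_iff] at hX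
    have h1 : i ∈ X \ l.toFinset := by simp [hX.1, hl'.2]
    have h2 := Finset.mul_prod_erase _ a h1
    have e1 : sgn F w l = ∏ j ∈ l.toFinset, (w j).eps F := (List.prod_toFinset _ hl'.1).symm
    have e2 : (l.map b).prod = ∏ j ∈ l.toFinset, b j := (List.prod_toFinset _ hl'.1).symm
    have h3 := ih hl'.1 hX.2
    rw [← h2] at h3
    have e4 : sgn F w (l ++ [i]) = sgn F w l * (w i).eps F := by simp [sgn]
    have e3 := sgn_mul_self (F := F) w l
    rw [cornerSum_concat, hs, Finset.sdiff_insert, e4, List.reverse_append, List.reverse_singleton,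
      List.singleton_append, chainSum, List.toFinset_reverse, ← e1, ← e2]
    linear_combination (w i).eps F * h3 - (w i).eps F * c i * (l.map b).prod *
      (∏ j ∈ (X \ l.toFinset).erase i, a j) * e3

end Products

/-! ### Words as enumerations of the variables -/

section Enumerations

variable {ι : Type*} [DecidableEq ι]

/-- The list `l` enumerates the finset `X` without repetitions. -/
def IsEnum (X : Finset ι) (l : List ι) : Prop := l.Nodup ∧ l.toFinset = X

theorem IsEnum.perm {X : Finset ι} {l l' : List ι} (h : IsEnum X l) (hp : l.Perm l') :
    IsEnum X l' :=
  ⟨hp.nodup_iff.1 h.1, by rw [← h.2]; exact (List.toFinset_eq_of_perm _ _ hp).symm⟩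

theorem IsEnum.length_eq {X : Finset ι} {l : List ι} (h : IsEnum X l) : l.length = X.card := by
  rw [← h.2, List.toFinset_card_of_nodup h.1]

theorem IsEnum.subset_left {X : Finset ι} {l r : List ι} (h : IsEnum X (l ++ r)) :
    l.toFinset ⊆ X := by
  rw [← h.2, List.toFinset_append]
  exact Finset.subset_union_left

theorem IsEnum.subset_right {X : Finset ι} {l r : List ι} (h : IsEnum X (l ++ r)) :
    r.toFinset ⊆ X := by
  rw [← h.2, List.toFinset_append]
  exact Finset.subset_union_right

theorem IsEnum.nodup_left {X : Finset ι} {l r : List ι} (h : IsEnum X (l ++ r)) : l.Nodup :=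
  h.1.of_append_left

theorem IsEnum.nodup_right {X : Finset ι} {l r : List ι} (h : IsEnum X (l ++ r)) : r.Nodup :=
  h.1.of_append_right

theorem IsEnum.toFinset_right {X : Finset ι} {l r : List ι} (h : IsEnum X (l ++ r)) :
    r.toFinset = X \ l.toFinset := by
  rw [← h.2, List.toFinset_append, Finset.union_sdiff_cancel_left]
  rw [Finset.disjoint_left]
  intro a ha hb
  exact (List.nodup_append.1 h.1).2.2 a (List.mem_toFinset.1 ha) a (List.mem_toFinset.1 hb) rfl

theorem IsEnum.comm {X : Finset ι} {l r : List ι} (h : IsEnum X (l ++ r)) : IsEnum X (r ++ l) :=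
  h.perm List.perm_append_comm

theorem IsEnum.prod_left {M : Type*} [CommMonoid M] {X : Finset ι} {l r : List ι}
    (h : IsEnum X (l ++ r)) (f : ι → M) : (l.map f).prod = ∏ i ∈ l.toFinset, f i :=
  (List.prod_toFinset _ h.nodup_left).symm

theorem IsEnum.prod_right {M : Type*} [CommMonoid M] {X : Finset ι} {l r : List ι}
    (h : IsEnum X (l ++ r)) (f : ι → M) : (r.map f).prod = ∏ i ∈ X \ l.toFinset, f i := by
  rw [← h.toFinset_right, List.prod_toFinset _ h.nodup_right]

theorem isEnum_toList_append {X S : Finset ι} (h : S ⊆ X) :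
    IsEnum X (S.toList ++ (X \ S).toList) := by
  constructor
  · rw [List.nodup_append]
    refine ⟨S.nodup_toList, Finset.nodup_toList _, ?_⟩
    rintro a ha b hb rfl
    rw [Finset.mem_toList] at ha hb
    exact (Finset.mem_sdiff.1 hb).2 ha
  · rw [List.toFinset_append, Finset.toList_toFinset, Finset.toList_toFinset,
      Finset.union_sdiff_of_subset h]

variable {n : ℕ}

theorem isEnum_ofFn (σ : Equiv.Perm (Fin n)) : IsEnum Finset.univ (List.ofFn σ) := by
  refine ⟨List.nodup_ofFn.2 σ.injective, ?_⟩
  ext i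
  simp only [List.mem_toFinset, List.mem_ofFn, Finset.mem_univ, iff_true]
  exact σ.surjective i

theorem IsEnum.exists_perm {l : List (Fin n)} (h : IsEnum Finset.univ l) :
    ∃ σ : Equiv.Perm (Fin n), List.ofFn σ = l := by
  have hlen : n = l.length := by simpa using h.length_eq.symm
  have hmem : ∀ x, x ∈ l := fun x => by
    rw [← List.mem_toFinset, h.2]; exact Finset.mem_univ x
  refine ⟨(finCongr hlen).trans (h.1.getEquivOfForallMemList l hmem), ?_⟩
  apply List.ext_getElem
  · simpa using hlen
  · intro i h1 h2
    simp

variable (w : Fin n → VarKind)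

/-- The indices of the odd variables. -/
def odds : Finset (Fin n) := Finset.univ.filter fun i => (w i).isOdd = true

/-- The indices of the even variables. -/
def evens : Finset (Fin n) := Finset.univ.filter fun i => (w i).isOdd = false

theorem ne_of_mem_evens_of_mem_odds {i x : Fin n} (hi : i ∈ evens w) (hx : x ∈ odds w) :
    i ≠ x := by
  rintro rfl
  have := (Finset.mem_filter.1 hx).2
  rw [(Finset.mem_filter.1 hi).2] at this
  cases this

theorem isEnum_univ_append_iff {l r : List (Fin n)} (hl : ∀ i ∈ l, (w i).isOdd = false)
    (hr : ∀ i ∈ r, (w i).isOdd = true) :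
    IsEnum Finset.univ (l ++ r) ↔ IsEnum (evens w) l ∧ IsEnum (odds w) r := by
  have hd : ∀ a ∈ l, ∀ b ∈ r, a ≠ b := by
    rintro a ha b hb rfl
    have := hl a ha
    rw [hr a hb] at this
    cases this
  unfold IsEnum
  rw [List.nodup_append]
  constructor
  · rintro ⟨⟨h1, h2, -⟩, h3⟩
    refine ⟨⟨h1, ?_⟩, h2, ?_⟩
    · ext i
      have hi : i ∈ (l ++ r).toFinset := by rw [h3]; exact Finset.mem_univ i
      simp only [List.toFinset_append, Finset.mem_union, List.mem_toFinset] at hi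
      simp only [List.mem_toFinset, evens, Finset.mem_filter, Finset.mem_univ, true_and]
      refine ⟨hl i, fun h => hi.resolve_right fun h' => ?_⟩
      rw [hr i h'] at h; cases h
    · ext i
      have hi : i ∈ (l ++ r).toFinset := by rw [h3]; exact Finset.mem_univ i
      simp only [List.toFinset_append, Finset.mem_union, List.mem_toFinset] at hi
      simp only [List.mem_toFinset, odds, Finset.mem_filter, Finset.mem_univ, true_and]
      refine ⟨hr i, fun h => hi.resolve_left fun h' => ?_⟩
      rw [hl i h'] at h; cases h
  · rintro ⟨⟨h1, h3⟩, h2, h4⟩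
    refine ⟨⟨h1, h2, hd⟩, ?_⟩
    rw [List.toFinset_append, h3, h4]
    ext i
    cases h : (w i).isOdd <;> simp [evens, odds, h]

theorem IsEnum.isOdd_eq_false {l : List (Fin n)} (h : IsEnum (evens w) l) :
    ∀ i ∈ l, (w i).isOdd = false := by
  intro i hi
  rw [← List.mem_toFinset, h.2] at hi
  exact (Finset.mem_filter.1 hi).2

theorem IsEnum.isOdd_eq_true {l : List (Fin n)} (h : IsEnum (odds w) l) :
    ∀ i ∈ l, (w i).isOdd = true := by
  intro i hi
  rw [← List.mem_toFinset, h.2] at hi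
  exact (Finset.mem_filter.1 hi).2

theorem IsEnum.filter_isOdd {l : List (Fin n)} (h : IsEnum Finset.univ l) :
    IsEnum (odds w) (l.filter fun i => (w i).isOdd) := by
  refine ⟨h.1.filter _, ?_⟩
  ext i
  have hi : i ∈ l.toFinset := by rw [h.2]; exact Finset.mem_univ i
  simp only [List.mem_toFinset] at hi
  simp [odds, hi]

theorem isOdd_eq_false_of_filter_eq_nil {l : List (Fin n)}
    (h : l.filter (fun i => (w i).isOdd) = []) : ∀ i ∈ l, (w i).isOdd = false := by
  intro i hi
  have := List.filter_eq_nil_iff.1 h i hi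
  simpa using this

/-- The decomposition of a word at its first odd letter. -/
theorem exists_eq_append_cons {l : List (Fin n)} {x : Fin n} {r : List (Fin n)}
    (h : l.filter (fun i => (w i).isOdd) = x :: r) :
    ∃ l₀ l', l = l₀ ++ x :: l' ∧ (∀ i ∈ l₀, (w i).isOdd = false) ∧ (w x).isOdd = true ∧
      l'.filter (fun i => (w i).isOdd) = r := by
  obtain ⟨l₀, l', rfl, h1, h2, h3⟩ := List.filter_eq_cons_iff.1 h
  exact ⟨l₀, l', rfl, fun i hi => by simpa using h1 i hi, h2, h3⟩

/-- The even segments of a word between its odd letters. -/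
def segments (l : List (Fin n)) : List (List (Fin n)) := l.splitOnP fun i => (w i).isOdd

theorem segments_even {l : List (Fin n)} (h : ∀ i ∈ l, (w i).isOdd = false) :
    segments w l = [l] :=
  List.splitOnP_eq_singleton h

theorem segments_append_cons {l : List (Fin n)} (h : ∀ i ∈ l, (w i).isOdd = false) {x : Fin n}
    (hx : (w x).isOdd = true) (r : List (Fin n)) :
    segments w (l ++ x :: r) = l :: segments w r :=
  List.splitOnP_append_cons_of_forall_mem h _ hx _

theorem filter_append_cons {l : List (Fin n)} (h : ∀ i ∈ l, (w i).isOdd = false) {x : Fin n}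
    (hx : (w x).isOdd = true) (r : List (Fin n)) :
    (l ++ x :: r).filter (fun i => (w i).isOdd) = x :: r.filter fun i => (w i).isOdd := by
  have : l.filter (fun i => (w i).isOdd) = [] :=
    List.filter_eq_nil_iff.2 fun i hi => by simp [h i hi]
  rw [List.filter_append, this, List.nil_append, List.filter_cons, if_pos hx]

end Enumerations

/-! ### Indicator substitutions -/

section Weights

variable {F : Type*} [Field F] {n : ℕ} (w : Fin n → VarKind)

theorem chainSum_mul {ι : Type*} [DecidableEq ι] (t : F) (wt : ι → Finset ι → F) (l : List ι) :
    chainSum (fun i S => t * wt i S) l = t * chainSum wt l := by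
  induction l with
  | nil => simp [chainSum]
  | cons i l ih => rw [chainSum, ih, chainSum]; ring

theorem chainSum_bottom {ι : Type*} [DecidableEq ι] (t : F) {l : List ι} (hl : l ≠ []) :
    chainSum (fun _ S => if S = ∅ then t else 0) l = t := by
  induction l with
  | nil => exact absurd rfl hl
  | cons i l ih =>
    rw [chainSum]
    rcases eq_or_ne l [] with rfl | h
    · simp [chainSum]
    · rw [ih h, if_neg (by simpa using h), zero_add]

/-- The product of indicator values that singles out the subset `T` of `X`. -/
theorem prod_indicator {ι : Type*} [DecidableEq ι] {X S T : Finset ι} (hT : T ⊆ X) :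
    (∏ i ∈ S, if i ∈ T then (1 : F) else 0) * ∏ i ∈ X \ S, (if i ∈ T then (0 : F) else 1) =
      if S = T then 1 else 0 := by
  split_ifs with h
  · subst h
    rw [Finset.prod_congr rfl fun i hi => if_pos hi,
      Finset.prod_congr rfl fun i hi => if_neg (Finset.mem_sdiff.1 hi).2]
    simp
  · by_cases hST : S ⊆ T
    · obtain ⟨i, hiT, hiS⟩ : ∃ i ∈ T, i ∉ S := by
        by_contra! hcon
        exact h (hST.antisymm hcon)
      rw [Finset.prod_eq_zero (i := i) (s := X \ S) (by simp [hT hiT, hiS]) (by simp [hiT]),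
        mul_zero]
    · obtain ⟨i, hiS, hiT⟩ := Finset.not_subset.1 hST
      rw [Finset.prod_eq_zero hiS (by simp [hiT]), zero_mul]

theorem extendZero_single {α : Type*} [DecidableEq α] {s : Finset α} {c : α} (hc : c ∈ s) (x : α) :
    extendZero F s (fun y => if y.1 = c then 1 else 0) x = if x = c then 1 else 0 :=
  extendZero_restrict (fun x => if x = c then (1 : F) else 0) fun hx =>
    if_neg (by rintro rfl; exact hx hc)

theorem range_le_of_single {α U : Type*} [DecidableEq α] [AddCommGroup U] [Module F U]
    {s : Finset α} (f : (s → F) →ₗ[F] U) {V : Submodule F U}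
    (h : ∀ c ∈ s, f (fun y => if y.1 = c then 1 else 0) ∈ V) : LinearMap.range f ≤ V := by
  rintro _ ⟨y, rfl⟩
  rw [pi_eq_sum_univ y, map_sum]
  refine Submodule.sum_mem _ fun c _ => ?_
  rw [map_smul]
  refine Submodule.smul_mem _ _ ?_
  convert h c.1 c.2 using 2
  ext y
  exact if_congr (by rw [Subtype.ext_iff, eq_comm]) rfl rfl

/-- The corner entries at indicator parameters give the sum of the weights that are concentrated
in the single edge `⟨i₀, S₀⟩`. -/
theorem chainSum_indicator {X : Finset (Fin n)} {i₀ : Fin n} {S₀ : Finset (Fin n)}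
    (h₀ : (⟨i₀, S₀⟩ : Σ _ : Fin n, Finset (Fin n)) ∈ edges X) {l : List (Fin n)} (hl : l.Nodup)
    (hX : l.toFinset ⊆ X) :
    chainSum (fun i S => (if i = i₀ then 1 else 0) * ((∏ j ∈ S, (w j).eps F) *
        ∏ j ∈ S, if j ∈ S₀ then 1 else 0) *
        ∏ j ∈ (X \ S).erase i, if j ∈ S₀ then 0 else 1) l =
      (∏ j ∈ S₀, (w j).eps F) *
        chainSumₗ F X (fun e => if e.1 = ⟨i₀, S₀⟩ then 1 else 0) l := by
  have h1 := chainSumₗ_restrict (F := F) (X := X)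
    (fun i S => if (⟨i, S⟩ : Σ _ : Fin n, Finset (Fin n)) = ⟨i₀, S₀⟩ then 1 else 0) hl hX
  rw [h1, ← chainSum_mul]
  refine chainSum_congr (X := X) ?_ hl hX
  intro i hi S hS
  by_cases hii : i = i₀
  · subst hii
    have e : (X \ S).erase i = X.erase i \ S := (Finset.erase_sdiff_comm _ _ _).symm
    have := prod_indicator (F := F) (S := S) (mem_edges.1 h₀).2
    rw [if_pos rfl, e, one_mul, mul_assoc, this]
    by_cases hSS : S = S₀
    · subst hSS; simp
    · simp [hSS]
  · rw [if_neg hii, if_neg (by rintro ⟨⟩; exact hii rfl)]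
    simp

theorem mem_evalSpace {f : Equiv.Perm (Fin n) → F} (a b c : Fin n → F) (i j : Fin 4) (t : F)
    (h : ∀ σ : Equiv.Perm (Fin n), f σ = t * value w a b c (List.ofFn σ) i j) :
    f ∈ evalSpace F w := by
  have : f = t • fun σ : Equiv.Perm (Fin n) => value w a b c (List.ofFn σ) i j := by
    ext σ; rw [h σ]; rfl
  rw [this]
  exact Submodule.smul_mem _ _ (Submodule.subset_span ⟨a, b, c, i, j, rfl⟩)

end Weights

/-! ### Words without odd letters -/

section NoOdd

variable {F : Type*} [Field F] {n : ℕ} (w : Fin n → VarKind)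

variable (F n) in
/-- The sums along all maximal chains of subsets of the set of indices. -/
noncomputable def maximalChainSum :
    (edges (Finset.univ : Finset (Fin n)) → F) →ₗ[F] (Equiv.Perm (Fin n) → F) :=
  (LinearMap.funLeft F F fun σ : Equiv.Perm (Fin n) => List.ofFn σ) ∘ₗ chainSumₗ F Finset.univ

theorem range_maximalChainSum (hn : 0 < n) (h : ∀ i, (w i).isOdd = false) :
    LinearMap.range (maximalChainSum F n) = evalSpace F w := by
  have hval : ∀ (a b c : Fin n → F) (σ : Equiv.Perm (Fin n)),
      value w a b c (List.ofFn σ) = evenMat (∏ i, a i) (∏ i, b i)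
        (chainSum (fun i S => c i * ((∏ j ∈ S, (w j).eps F) * ∏ j ∈ S, b j) *
          ∏ j ∈ (Finset.univ \ S).erase i, a j) (List.ofFn σ))
        (chainSum (fun i S => ((w i).eps F * c i) * ((∏ j ∈ S, (w j).eps F) * ∏ j ∈ S, a j) *
          ∏ j ∈ (Finset.univ \ S).erase i, b j) (List.ofFn σ)) (∏ i, (w i).eps F) := by
    intro a b c σ
    obtain ⟨h1, h2⟩ := isEnum_ofFn σ
    have hp : ∀ f : Fin n → F, ((List.ofFn σ).map f).prod = ∏ i, f i := by
      intro f; rw [← h2, List.prod_toFinset _ h1]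
    rw [value_even w a b c fun i _ => h i, hp, hp, sgn, hp,
      ← chainSum_cornerSum w a b c h1 (Finset.subset_univ _),
      ← chainSum_cornerSum w b a (fun i => (w i).eps F * c i) h1 (Finset.subset_univ _), h2]
    simp
  apply le_antisymm
  · refine range_le_of_single _ ?_
    rintro ⟨i₀, S₀⟩ h₀
    refine mem_evalSpace w (fun j => if j ∈ S₀ then 0 else 1) (fun j => if j ∈ S₀ then 1 else 0)
      (fun i => if i = i₀ then 1 else 0) 0 2 (∏ j ∈ S₀, (w j).eps F)⁻¹ fun σ => ?_
    have h1 := isEnum_ofFn σ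
    have h2 := chainSum_indicator (F := F) w h₀ h1.1 (Finset.subset_univ _)
    have h3 : (∏ j ∈ S₀, (w j).eps F) ≠ 0 :=
      Finset.prod_ne_zero_iff.2 fun j _ => (w j).eps_ne_zero
    rw [hval]
    change _ = _ * chainSum _ _
    rw [h2, inv_mul_cancel_left₀ h3]
    rfl
  · rw [evalSpace, Submodule.span_le]
    rintro _ ⟨a, b, c, i, j, rfl⟩
    have hchain : ∀ wt : Fin n → Finset (Fin n) → F,
        (fun σ : Equiv.Perm (Fin n) => chainSum wt (List.ofFn σ)) ∈
          LinearMap.range (maximalChainSum F n) := by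
      intro wt
      refine ⟨fun e => wt e.1.1 e.1.2, ?_⟩
      ext σ
      exact chainSumₗ_restrict wt (isEnum_ofFn σ).1 (Finset.subset_univ _)
    have hconst : ∀ t : F, (fun _ : Equiv.Perm (Fin n) => t) ∈
        LinearMap.range (maximalChainSum F n) := by
      intro t
      convert hchain fun _ S => if S = ∅ then t else 0 using 2 with σ
      rw [chainSum_bottom (F := F)]
      intro h0
      have := congrArg List.length h0
      simp at this
      omega
    simp only [hval, SetLike.mem_coe]
    fin_cases i <;> fin_cases j <;>
      first
        | exact hconst _
        | exact hchain _

/-- The weights with zero sum along all maximal chains are the coboundaries of the functions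
that vanish on `∅` and on the whole set. -/
theorem finrank_evalSpace_noOdd (hn : 0 < n) (h : ∀ i, (w i).isOdd = false) :
    Module.finrank F (evalSpace F w) + (2 ^ n - 2) = n * 2 ^ (n - 1) := by
  rw [← range_maximalChainSum w hn h]
  let V : Finset (Finset (Fin n)) := Finset.univ \ {∅, Finset.univ}
  have hne : (∅ : Finset (Fin n)) ≠ Finset.univ := by
    intro h0
    have := Finset.mem_univ (⟨0, hn⟩ : Fin n)
    rw [← h0] at this
    simp at this
  have hV : V.card = 2 ^ n - 2 := by
    rw [Finset.card_sdiff_of_subset (Finset.subset_univ _), Finset.card_pair hne]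
    simp
  have hV0 : ∅ ∉ V := by simp [V]
  have hV1 : Finset.univ ∉ V := by simp [V]
  have hinj := coboundary_injective (F := F) (X := Finset.univ) hV0 fun S _ => S.subset_univ
  have key := finrank_range_add_of_exact (f := coboundary F Finset.univ V)
    (g := maximalChainSum F n) hinj ?_
  · simpa [hV, card_edges] using key
  · ext wt
    constructor
    · rintro ⟨h, rfl⟩
      rw [LinearMap.mem_ker]
      ext σ
      have h1 := isEnum_ofFn σ
      refine (chainSumₗ_coboundary hV0 h h1.1 (Finset.subset_univ _)).trans ?_
      rw [h1.2, extendZero_notMem _ hV1]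
      rfl
    · intro hwt
      obtain ⟨h, h0, hX, hh⟩ := exists_potential (X := Finset.univ) (C := (0 : F))
        (wt := fun i S => extendZero F (edges Finset.univ) wt ⟨i, S⟩) (by
          intro l hl hlX
          obtain ⟨σ, rfl⟩ := IsEnum.exists_perm ⟨hl, hlX⟩
          exact congrFun hwt σ)
      refine ⟨fun S => h S, eq_coboundary ?_ hh⟩
      intro S _ hS
      have : S = ∅ ∨ S = Finset.univ := by
        by_contra hc
        exact hS (by simpa [V] using hc)
      rcases this with rfl | rfl
      exacts [h0, hX]

end NoOdd

/-! ### Words with one odd letter -/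

section OneOdd

variable {F : Type*} [Field F] {n : ℕ} (w : Fin n → VarKind)

theorem exists_split_one (hO : (odds w).card = 1) {l : List (Fin n)}
    (hl : IsEnum Finset.univ l) :
    ∃ l₀ x l₁, l = l₀ ++ x :: l₁ ∧ IsEnum (evens w) (l₀ ++ l₁) ∧ IsEnum (odds w) [x] := by
  have hf := hl.filter_isOdd w
  obtain ⟨x, hx⟩ := List.length_eq_one_iff.1 (hf.length_eq.trans hO)
  obtain ⟨l₀, l₁, rfl, h₀, hxo, hr⟩ := exists_eq_append_cons w hx
  have h₁ := isOdd_eq_false_of_filter_eq_nil w hr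
  refine ⟨l₀, x, l₁, rfl, ?_⟩
  rw [← isEnum_univ_append_iff w]
  · exact hl.perm (List.perm_middle.trans (List.perm_append_singleton _ _).symm)
  · simpa [List.forall_mem_append, or_imp, forall_and] using ⟨h₀, h₁⟩
  · simpa using hxo

theorem exists_perm_one {l₀ l₁ : List (Fin n)} {x : Fin n} (hE : IsEnum (evens w) (l₀ ++ l₁))
    (hx : IsEnum (odds w) [x]) : ∃ σ : Equiv.Perm (Fin n), List.ofFn σ = l₀ ++ x :: l₁ := by
  have h := (isEnum_univ_append_iff w (hE.isOdd_eq_false w) (hx.isOdd_eq_true w)).2 ⟨hE, hx⟩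
  exact (h.perm ((List.perm_append_singleton _ _).trans List.perm_middle.symm)).exists_perm

theorem segments_one {l₀ l₁ : List (Fin n)} {x : Fin n} (hE : IsEnum (evens w) (l₀ ++ l₁))
    (hx : IsEnum (odds w) [x]) : segments w (l₀ ++ x :: l₁) = [l₀, l₁] := by
  have h := List.forall_mem_append.1 (hE.isOdd_eq_false w)
  rw [segments_append_cons w h.1 (hx.isOdd_eq_true w x (by simp)), segments_even w h.2]

variable (F) in
/-- The functions on words `l₀ x l₁` with a single odd letter `x` that are determined by the set of
the letters of `l₀` and by the chains of subsets that grow from `x` to the left and to the right. -/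
noncomputable def oneOddMap (x : Fin n) :
    ((evens w).powerset → F) × (edges (evens w) → F) →ₗ[F] (Equiv.Perm (Fin n) → F) where
  toFun y σ :=
    match segments w (List.ofFn σ) with
    | [l₀, l₁] => sgn F w l₁ * (extendZero F _ y.1 l₀.toFinset +
        (w x).eps F * chainSumₗ F _ y.2 l₀ + chainSumₗ F _ y.2 l₁.reverse)
    | _ => 0
  map_add' y y' := by
    ext σ
    simp only [Prod.fst_add, Prod.snd_add, map_add, Pi.add_apply]
    split
    · ring
    · simp
  map_smul' t y := by
    ext σ
    simp only [Prod.smul_fst, Prod.smul_snd, map_smul, Pi.smul_apply, smul_eq_mul,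
      RingHom.id_apply]
    split
    · ring
    · simp

theorem oneOddMap_apply {x : Fin n} (hx : IsEnum (odds w) [x]) (y) {σ : Equiv.Perm (Fin n)}
    {l₀ l₁ : List (Fin n)} (hE : IsEnum (evens w) (l₀ ++ l₁)) (hσ : List.ofFn σ = l₀ ++ x :: l₁) :
    oneOddMap F w x y σ = sgn F w l₁ * (extendZero F _ y.1 l₀.toFinset +
        (w x).eps F * chainSumₗ F _ y.2 l₀ + chainSumₗ F _ y.2 l₁.reverse) := by
  change (match segments w (List.ofFn σ) with
    | [l₀, l₁] => sgn F w l₁ * (extendZero F _ y.1 l₀.toFinset +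
        (w x).eps F * chainSumₗ F _ y.2 l₀ + chainSumₗ F _ y.2 l₁.reverse)
    | _ => 0) = _
  rw [hσ, segments_one w hE hx]

theorem mem_range_oneOddMap {x : Fin n} (hx : IsEnum (odds w) [x])
    {f : Equiv.Perm (Fin n) → F} (g : Finset (Fin n) → F) (wt : Fin n → Finset (Fin n) → F)
    (hf : ∀ (σ : Equiv.Perm (Fin n)) (l₀ l₁ : List (Fin n)), IsEnum (evens w) (l₀ ++ l₁) →
      List.ofFn σ = l₀ ++ x :: l₁ → f σ = sgn F w l₁ *
        (g l₀.toFinset + (w x).eps F * chainSum wt l₀ + chainSum wt l₁.reverse)) :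
    f ∈ LinearMap.range (oneOddMap F w x) := by
  refine ⟨(fun S => g S, fun e => wt e.1.1 e.1.2), ?_⟩
  ext σ
  obtain ⟨l₀, x', l₁, hσ, hE, hx'⟩ := exists_split_one w hx.length_eq.symm (isEnum_ofFn σ)
  obtain rfl : x' = x := by
    have := hx'.2.trans hx.2.symm
    simpa using this
  rw [oneOddMap_apply w hx _ hE hσ, hf σ l₀ l₁ hE hσ,
    extendZero_mem _ (Finset.mem_powerset.2 hE.subset_left),
    chainSumₗ_restrict wt hE.nodup_left hE.subset_left,
    chainSumₗ_restrict wt (List.nodup_reverse.2 hE.nodup_right)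
      (by rw [List.toFinset_reverse]; exact hE.subset_right)]

theorem IsEnum.sgn_left {l r : List (Fin n)} (hE : IsEnum (evens w) (l ++ r)) :
    sgn F w l = ∏ i ∈ l.toFinset, (w i).eps F := hE.prod_left _

theorem IsEnum.sgn_right {l r : List (Fin n)} (hE : IsEnum (evens w) (l ++ r)) :
    sgn F w r = ∏ i ∈ evens w \ l.toFinset, (w i).eps F := hE.prod_right _

theorem range_oneOddMap {x : Fin n} (hx : IsEnum (odds w) [x]) :
    LinearMap.range (oneOddMap F w x) = evalSpace F w := by
  have hxo := hx.isOdd_eq_true w x (by simp)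
  have hne : ∀ i ∈ evens w, i ≠ x := fun i hi =>
    ne_of_mem_evens_of_mem_odds w hi (by rw [← hx.2]; simp)
  have hval : ∀ (a b c : Fin n → F) (σ : Equiv.Perm (Fin n)) (l₀ l₁ : List (Fin n)),
      IsEnum (evens w) (l₀ ++ l₁) → List.ofFn σ = l₀ ++ x :: l₁ →
      value w a b c (List.ofFn σ) = oddMat
        ((∏ i ∈ l₀.toFinset, a i) * a x * ∏ i ∈ evens w \ l₀.toFinset, b i)
        ((∏ i ∈ l₀.toFinset, b i) * (if (w x).isSkew then b x else 0) *
          (sgn F w l₁ * ∏ i ∈ evens w \ l₀.toFinset, b i))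
        ((∏ i ∈ l₀.toFinset, (w i).eps F) * (∏ i ∈ l₀.toFinset, b i) * ((w x).eps F * a x) *
          (sgn F w l₁ * ∏ i ∈ evens w \ l₀.toFinset, a i))
        (sgn F w l₁ * ((∏ i ∈ l₀.toFinset, a i) * (if (w x).isSkew then 0 else b x) *
            (∏ i ∈ evens w \ l₀.toFinset, a i) +
          (w x).eps F * chainSum (fun i S => a x * (c i * ((∏ j ∈ S, (w j).eps F) *
            ∏ j ∈ S, b j) * ∏ j ∈ (evens w \ S).erase i, a j)) l₀ +
          chainSum (fun i S => a x * (c i * ((∏ j ∈ S, (w j).eps F) *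
            ∏ j ∈ S, b j) * ∏ j ∈ (evens w \ S).erase i, a j)) l₁.reverse)) := by
    intro a b c σ l₀ l₁ hE hσ
    have h := List.forall_mem_append.1 (hE.isOdd_eq_false w)
    have e1 := chainSum_cornerSum w a b c hE.nodup_left hE.subset_left
    have e2 := chainSum_cornerSum_reverse w a b c hE.nodup_right hE.subset_right
    have e3 : evens w \ l₁.toFinset = l₀.toFinset := hE.comm.toFinset_right.symm
    rw [e3] at e2
    rw [hσ, value_one_odd w a b c h.1 h.2 hxo, chainSum_mul, chainSum_mul, ← e1,
      hE.prod_left, hE.prod_left, hE.prod_right, hE.prod_right, hE.sgn_left]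
    congr 1
    linear_combination a x * e2
  apply le_antisymm
  · have hx0 : ∀ S ⊆ evens w, x ∉ S := fun S hS hxS => hne x (hS hxS) rfl
    have h1 : LinearMap.range (oneOddMap F w x ∘ₗ LinearMap.inl F _ _) ≤ evalSpace F w := by
      refine range_le_of_single _ fun S₀ hS₀ => ?_
      rw [Finset.mem_powerset] at hS₀
      refine mem_evalSpace w (fun j => if j ∈ insert x S₀ then 1 else 0)
        (fun j => if j ∈ S₀ then 0 else 1) 0 0 1 (∏ j ∈ evens w \ S₀, (w j).eps F) fun σ => ?_
      obtain ⟨l₀, x', l₁, hσ, hE, hx'⟩ := exists_split_one w hx.length_eq.symm (isEnum_ofFn σ)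
      obtain rfl : x' = x := by simpa using hx'.2.trans hx.2.symm
      have hl₀ : (∏ j ∈ l₀.toFinset, if j ∈ insert x' S₀ then (1 : F) else 0) =
          ∏ j ∈ l₀.toFinset, if j ∈ S₀ then 1 else 0 :=
        Finset.prod_congr rfl fun j hj => by
          simp only [Finset.mem_insert, hne j (hE.subset_left hj), false_or]
      have hi := prod_indicator (F := F) (S := l₀.toFinset) hS₀
      rw [hval _ _ _ σ l₀ l₁ hE hσ, LinearMap.comp_apply, oneOddMap_apply w hx _ hE hσ,
        LinearMap.inl_apply, extendZero_single (Finset.mem_powerset.2 hS₀), map_zero, hl₀]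
      simp only [oddMat, Matrix.of_apply, Matrix.cons_val, Pi.zero_apply]
      rw [if_pos (Finset.mem_insert_self _ _), mul_one, hi]
      split_ifs with h
      · rw [hE.sgn_right, h]; ring
      · ring
    have h2 : LinearMap.range (oneOddMap F w x ∘ₗ LinearMap.inr F _ _) ≤ evalSpace F w := by
      refine range_le_of_single _ ?_
      rintro ⟨i₀, S₀⟩ h₀
      have hS₀ : x ∉ S₀ := hx0 S₀ ((mem_edges.1 h₀).2.trans (Finset.erase_subset _ _))
      refine mem_evalSpace w (fun j => if j ∈ S₀ then 0 else 1)
        (fun j => if j ∈ S₀ then 1 else 0) (fun i => if i = i₀ then 1 else 0) 0 3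
        (∏ j ∈ S₀, (w j).eps F)⁻¹ fun σ => ?_
      obtain ⟨l₀, x', l₁, hσ, hE, hx'⟩ := exists_split_one w hx.length_eq.symm (isEnum_ofFn σ)
      obtain rfl : x' = x := by simpa using hx'.2.trans hx.2.symm
      have h3 : (∏ j ∈ S₀, (w j).eps F) ≠ 0 :=
        Finset.prod_ne_zero_iff.2 fun j _ => (w j).eps_ne_zero
      rw [hval _ _ _ σ l₀ l₁ hE hσ, LinearMap.comp_apply, oneOddMap_apply w hx _ hE hσ,
        LinearMap.inr_apply, map_zero, if_neg hS₀, if_neg hS₀]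
      simp only [oddMat, Matrix.of_apply, Matrix.cons_val, Pi.zero_apply, one_mul]
      rw [chainSum_indicator w h₀ hE.nodup_left hE.subset_left,
        chainSum_indicator w h₀ (List.nodup_reverse.2 hE.nodup_right)
          (by rw [List.toFinset_reverse]; exact hE.subset_right)]
      field_simp
      simp
      ring
    rintro _ ⟨⟨g, wt⟩, rfl⟩
    have e : (g, wt) = LinearMap.inl F _ _ g + LinearMap.inr F _ _ wt := by simp
    rw [e, map_add]
    exact Submodule.add_mem _ (h1 ⟨g, rfl⟩) (h2 ⟨wt, rfl⟩)
  · rw [evalSpace, Submodule.span_le]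
    rintro _ ⟨a, b, c, i, j, rfl⟩
    have hfun : ∀ f : Equiv.Perm (Fin n) → F, ∀ (g : Finset (Fin n) → F),
        (∀ (σ : Equiv.Perm (Fin n)) (l₀ l₁ : List (Fin n)), IsEnum (evens w) (l₀ ++ l₁) →
          List.ofFn σ = l₀ ++ x :: l₁ → f σ = sgn F w l₁ * g l₀.toFinset) →
        f ∈ LinearMap.range (oneOddMap F w x) := by
      intro f g hf
      refine mem_range_oneOddMap w hx g (fun _ _ => 0) fun σ l₀ l₁ hE hσ => ?_
      have h0 : ∀ l : List (Fin n), chainSum (fun _ _ => (0 : F)) l = 0 := by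
        intro l
        induction l with
        | nil => rfl
        | cons i l ih => rw [chainSum, ih, zero_add]
      rw [hf σ l₀ l₁ hE hσ, h0, h0]
      ring
    have hs := fun l => sgn_mul_self (F := F) w l
    have h01 : (fun σ : Equiv.Perm (Fin n) => value w a b c (List.ofFn σ) 0 1) ∈
        LinearMap.range (oneOddMap F w x) := by
      refine hfun _ (fun S => (∏ i ∈ S, a i) * a x * (∏ i ∈ evens w \ S, b i) *
        ∏ i ∈ evens w \ S, (w i).eps F) fun σ l₀ l₁ hE hσ => ?_
      rw [hval a b c σ l₀ l₁ hE hσ, ← hE.sgn_right]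
      simp only [oddMat, Matrix.of_apply, Matrix.cons_val]
      linear_combination -((∏ i ∈ l₀.toFinset, a i) * a x *
        (∏ i ∈ evens w \ l₀.toFinset, b i)) * hs l₁
    have h12 : (fun σ : Equiv.Perm (Fin n) => value w a b c (List.ofFn σ) 1 2) ∈
        LinearMap.range (oneOddMap F w x) := by
      refine hfun _ (fun S => (∏ i ∈ S, b i) * (if (w x).isSkew then b x else 0) *
        (∏ i ∈ evens w \ S, b i)) fun σ l₀ l₁ hE hσ => ?_
      rw [hval a b c σ l₀ l₁ hE hσ]
      simp only [oddMat, Matrix.of_apply, Matrix.cons_val]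
      ring
    have h23 : (fun σ : Equiv.Perm (Fin n) => value w a b c (List.ofFn σ) 2 3) ∈
        LinearMap.range (oneOddMap F w x) := by
      refine hfun _ (fun S => (∏ i ∈ S, (w i).eps F) * (∏ i ∈ S, b i) * ((w x).eps F * a x) *
        (∏ i ∈ evens w \ S, a i)) fun σ l₀ l₁ hE hσ => ?_
      rw [hval a b c σ l₀ l₁ hE hσ]
      simp only [oddMat, Matrix.of_apply, Matrix.cons_val]
      ring
    have h03 : (fun σ : Equiv.Perm (Fin n) => value w a b c (List.ofFn σ) 0 3) ∈
        LinearMap.range (oneOddMap F w x) := by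
      refine mem_range_oneOddMap w hx (fun S => (∏ i ∈ S, a i) *
        (if (w x).isSkew then 0 else b x) * (∏ i ∈ evens w \ S, a i))
        (fun i S => a x * (c i * ((∏ j ∈ S, (w j).eps F) * ∏ j ∈ S, b j) *
          ∏ j ∈ (evens w \ S).erase i, a j))
        fun σ l₀ l₁ hE hσ => ?_
      rw [hval a b c σ l₀ l₁ hE hσ]
      rfl
    have h0 : ∀ i j, ((i, j) : Fin 4 × Fin 4) ≠ (0, 1) → (i, j) ≠ (1, 2) → (i, j) ≠ (2, 3) →
        (i, j) ≠ (0, 3) → (fun σ : Equiv.Perm (Fin n) => value w a b c (List.ofFn σ) i j) ∈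
          LinearMap.range (oneOddMap F w x) := by
      intro i j h1 h2 h3 h4
      refine hfun _ (fun _ => 0) fun σ l₀ l₁ hE hσ => ?_
      rw [hval a b c σ l₀ l₁ hE hσ, mul_zero]
      fin_cases i <;> fin_cases j <;> first | rfl | exact absurd rfl ‹_›
    by_cases h1 : (i, j) = (0, 1)
    · obtain ⟨rfl, rfl⟩ := Prod.ext_iff.1 h1; exact h01
    by_cases h2 : (i, j) = (1, 2)
    · obtain ⟨rfl, rfl⟩ := Prod.ext_iff.1 h2; exact h12
    by_cases h3 : (i, j) = (2, 3)
    · obtain ⟨rfl, rfl⟩ := Prod.ext_iff.1 h3; exact h23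
    by_cases h4 : (i, j) = (0, 3)
    · obtain ⟨rfl, rfl⟩ := Prod.ext_iff.1 h4; exact h03
    exact h0 i j h1 h2 h3 h4

/-- The relations between the functions in the range of `oneOddMap` correspond to the
functions on sets of even letters that vanish on `∅`: such a function is the potential of the
weights of the relation. -/
theorem finrank_evalSpace_oneOdd (hO : (odds w).card = 1) :
    Module.finrank F (evalSpace F w) = 1 + (evens w).card * 2 ^ ((evens w).card - 1) := by
  obtain ⟨x, hxO⟩ := Finset.card_eq_one.1 hO
  have hx : IsEnum (odds w) [x] := ⟨List.nodup_singleton x, by rw [hxO]; rfl⟩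
  rw [← range_oneOddMap w hx]
  let V : Finset (Finset (Fin n)) := (evens w).powerset.erase ∅
  have hV0 : ∅ ∉ V := by simp [V]
  have hVX : ∀ S ∈ V, S ⊆ evens w := fun S hS =>
    Finset.mem_powerset.1 (Finset.mem_of_mem_erase hS)
  have hVc : V.card + 1 = 2 ^ (evens w).card := by
    rw [← Finset.card_powerset]
    exact Finset.card_erase_add_one (Finset.empty_mem_powerset _)
  have hinj := coboundary_injective (F := F) hV0 hVX
  let R : (V → F) →ₗ[F] ((evens w).powerset → F) :=
    { toFun := fun h S => -((w x).eps F * extendZero F V h S + extendZero F V h (evens w \ S))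
      map_add' := fun h h' => by ext S; simp; ring
      map_smul' := fun t h => by ext S; simp; ring }
  have key := finrank_range_add_of_exact (f := R.prod (coboundary F (evens w) V))
    (g := oneOddMap F w x) (fun h h' hh => hinj (congrArg Prod.snd hh)) ?_
  · rw [Module.finrank_prod] at key
    simp only [Module.finrank_fintype_fun_eq_card, Fintype.card_coe, card_edges,
      Finset.card_powerset] at key
    omega
  · -- the value of `oneOddMap` on weights that are a coboundary
    have hcob : ∀ (g : (evens w).powerset → F) (h : V → F) (σ : Equiv.Perm (Fin n))
        (l₀ l₁ : List (Fin n)), IsEnum (evens w) (l₀ ++ l₁) → List.ofFn σ = l₀ ++ x :: l₁ →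
        oneOddMap F w x (g, coboundary F (evens w) V h) σ = sgn F w l₁ *
          (extendZero F _ g l₀.toFinset + (w x).eps F * extendZero F V h l₀.toFinset +
            extendZero F V h (evens w \ l₀.toFinset)) := by
      intro g h σ l₀ l₁ hE hσ
      rw [oneOddMap_apply w hx _ hE hσ, chainSumₗ_coboundary hV0 h hE.nodup_left hE.subset_left,
        chainSumₗ_coboundary hV0 h (List.nodup_reverse.2 hE.nodup_right)
          (by rw [List.toFinset_reverse]; exact hE.subset_right),
        List.toFinset_reverse, hE.toFinset_right]
    ext ⟨g, wt⟩
    constructor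
    · rintro ⟨h, hh⟩
      obtain ⟨rfl, rfl⟩ := Prod.ext_iff.1 hh
      rw [LinearMap.mem_ker]
      ext σ
      obtain ⟨l₀, x', l₁, hσ, hE, hx'⟩ := exists_split_one w hO (isEnum_ofFn σ)
      obtain rfl : x' = x := by simpa using hx'.2.trans hx.2.symm
      refine (hcob _ h σ l₀ l₁ hE hσ).trans ?_
      rw [extendZero_mem _ (Finset.mem_powerset.2 hE.subset_left)]
      change _ * (-((w x').eps F * extendZero F V h l₀.toFinset +
        extendZero F V h (evens w \ l₀.toFinset)) + _ + _) = (0 : F)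
      ring
    · intro hwt
      -- words that begin with the odd letter show that the weights have a potential
      obtain ⟨h, h0, -, hh⟩ := exists_potential (X := evens w)
        (C := -extendZero F (evens w).powerset g ∅)
        (wt := fun i S => extendZero F (edges (evens w)) wt ⟨i, S⟩) (by
          intro l hl hlX
          have hE : IsEnum (evens w) ([] ++ l.reverse) :=
            ⟨by simpa using hl, by simpa using hlX⟩
          obtain ⟨σ, hσ⟩ := exists_perm_one w hE hx
          have := congrFun hwt σ
          rw [oneOddMap_apply w hx _ hE hσ, Pi.zero_apply, mul_eq_zero,
            or_iff_right (sgn_ne_zero w _), List.reverse_reverse] at this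
          change chainSumₗ F (evens w) wt l = _
          have e : chainSumₗ F (evens w) wt [] = 0 := rfl
          rw [e] at this
          simp only [List.toFinset_nil, mul_zero, add_zero] at this
          linear_combination this)
      have hwt' : coboundary F (evens w) V (fun S => h S) = wt := by
        refine eq_coboundary ?_ hh
        intro S hS hSV
        by_cases hS0 : S = ∅
        · rw [hS0, h0]
        · exact absurd (Finset.mem_erase.2 ⟨hS0, Finset.mem_powerset.2 hS⟩) hSV
      refine ⟨fun S => h S, Prod.ext ?_ hwt'⟩
      ext ⟨S, hS⟩
      have hE := isEnum_toList_append (Finset.mem_powerset.1 hS)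
      obtain ⟨σ, hσ⟩ := exists_perm_one w hE hx
      have := congrFun hwt σ
      rw [← hwt', hcob _ _ σ _ _ hE hσ, Pi.zero_apply, mul_eq_zero,
        or_iff_right (sgn_ne_zero w _), Finset.toList_toFinset, extendZero_mem _ hS] at this
      change -((w x).eps F * extendZero F V _ S + extendZero F V _ (evens w \ S)) = _
      linear_combination -this

end OneOdd

/-! ### Words with two odd letters -/

section TwoOdd

variable {F : Type*} [Field F] {n : ℕ} (w : Fin n → VarKind)

theorem exists_split_two (hO : (odds w).card = 2) {l : List (Fin n)}
    (hl : IsEnum Finset.univ l) :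
    ∃ l₀ x l₁ y l₂, l = l₀ ++ x :: (l₁ ++ y :: l₂) ∧ IsEnum (evens w) (l₀ ++ (l₁ ++ l₂)) ∧
      IsEnum (odds w) [x, y] := by
  have hf := hl.filter_isOdd w
  obtain ⟨x, y, hxy⟩ := List.length_eq_two.1 (hf.length_eq.trans hO)
  obtain ⟨l₀, l', rfl, h₀, hxo, hr⟩ := exists_eq_append_cons w hxy
  obtain ⟨l₁, l₂, rfl, h₁, hyo, hr⟩ := exists_eq_append_cons w hr
  have h₂ := isOdd_eq_false_of_filter_eq_nil w hr
  refine ⟨l₀, x, l₁, y, l₂, rfl, ?_, hxy ▸ hf⟩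
  refine ((isEnum_univ_append_iff w (r := [x, y]) ?_ ?_).1 (hl.perm ?_)).1
  · simp only [List.mem_append]
    rintro i (h | h | h)
    exacts [h₀ i h, h₁ i h, h₂ i h]
  · simpa using ⟨hxo, hyo⟩
  · rw [List.perm_iff_count]
    intro i
    simp only [List.count_append, List.count_cons, List.count_nil]
    omega

theorem exists_perm_two {l₀ l₁ l₂ : List (Fin n)} {x y : Fin n}
    (hE : IsEnum (evens w) (l₀ ++ (l₁ ++ l₂))) (hx : IsEnum (odds w) [x, y]) :
    ∃ σ : Equiv.Perm (Fin n), List.ofFn σ = l₀ ++ x :: (l₁ ++ y :: l₂) := by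
  have h := (isEnum_univ_append_iff w (hE.isOdd_eq_false w) (hx.isOdd_eq_true w)).2 ⟨hE, hx⟩
  refine (h.perm ?_).exists_perm
  rw [List.perm_iff_count]
  intro i
  simp only [List.count_append, List.count_cons, List.count_nil]
  omega

/-- Coordinates for the functions on words `l₀ x l₁ y l₂` with the odd letters `x` and `y`: the
pair `(x, y)` together with the set of letters of `l₀` (if `y` is skew) or of `l₂` (if `x` is
skew). If both letters are skew, the constants occur among the functions of `l₀` and among those
of `l₂`; the coordinate of `l₂ = ∅` is therefore left out. -/
def twoOddCoords : Finset (Σ _ : Fin n × Fin n, Finset (Fin n) ⊕ Finset (Fin n)) :=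
  (odds w).offDiag.sigma fun p =>
    (if (w p.2).isSkew then (evens w).powerset else ∅).disjSum
      (if (w p.1).isSkew then
        if (w p.2).isSkew then (evens w).powerset.erase ∅ else (evens w).powerset
      else ∅)

theorem inl_mem_twoOddCoords {x y : Fin n} {S : Finset (Fin n)} :
    ⟨(x, y), Sum.inl S⟩ ∈ twoOddCoords w ↔
      (x, y) ∈ (odds w).offDiag ∧ (w y).isSkew = true ∧ S ⊆ evens w := by
  rw [twoOddCoords, Finset.mem_sigma, Finset.inl_mem_disjSum]
  split_ifs with h <;> simp [h]

theorem inr_mem_twoOddCoords {x y : Fin n} {S : Finset (Fin n)} :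
    ⟨(x, y), Sum.inr S⟩ ∈ twoOddCoords w ↔
      (x, y) ∈ (odds w).offDiag ∧ (w x).isSkew = true ∧ S ⊆ evens w ∧
        ((w y).isSkew = true → S ≠ ∅) := by
  rw [twoOddCoords, Finset.mem_sigma, Finset.inr_mem_disjSum]
  cases h : (w x).isSkew <;> cases h' : (w y).isSkew <;> simp [*, and_comm]

variable (F) in
/-- The functions on words `l₀ x l₁ y l₂` with two odd letters that are, up to the sign of `l₁`,
sums of a function of `l₀` and a function of `l₂`. -/
noncomputable def twoOddMap : (twoOddCoords w → F) →ₗ[F] (Equiv.Perm (Fin n) → F) where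
  toFun u σ :=
    match segments w (List.ofFn σ), (List.ofFn σ).filter (fun i => (w i).isOdd) with
    | [l₀, l₁, l₂], [x, y] => sgn F w l₁ * (extendZero F _ u ⟨(x, y), Sum.inl l₀.toFinset⟩ +
        extendZero F _ u ⟨(x, y), Sum.inr l₂.toFinset⟩)
    | _, _ => 0
  map_add' u u' := by
    ext σ
    simp only [map_add, Pi.add_apply]
    split
    · ring
    · simp
  map_smul' t u := by
    ext σ
    simp only [map_smul, Pi.smul_apply, smul_eq_mul, RingHom.id_apply]
    split
    · ring
    · simp

theorem twoOddMap_apply (u) {σ : Equiv.Perm (Fin n)} {l₀ l₁ l₂ : List (Fin n)} {x y : Fin n}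
    (hE : IsEnum (evens w) (l₀ ++ (l₁ ++ l₂))) (hx : IsEnum (odds w) [x, y])
    (hσ : List.ofFn σ = l₀ ++ x :: (l₁ ++ y :: l₂)) :
    twoOddMap F w u σ = sgn F w l₁ * (extendZero F _ u ⟨(x, y), Sum.inl l₀.toFinset⟩ +
        extendZero F _ u ⟨(x, y), Sum.inr l₂.toFinset⟩) := by
  change (match segments w (List.ofFn σ), (List.ofFn σ).filter (fun i => (w i).isOdd) with
    | [l₀, l₁, l₂], [x, y] => sgn F w l₁ * (extendZero F _ u ⟨(x, y), Sum.inl l₀.toFinset⟩ +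
        extendZero F _ u ⟨(x, y), Sum.inr l₂.toFinset⟩)
    | _, _ => 0) = _
  have h := List.forall_mem_append.1 (hE.isOdd_eq_false w)
  have h' := List.forall_mem_append.1 h.2
  have hxo := hx.isOdd_eq_true w x (by simp)
  have hyo := hx.isOdd_eq_true w y (by simp)
  have h2 : l₂.filter (fun i => (w i).isOdd) = [] :=
    List.filter_eq_nil_iff.2 fun i hi => by simp [h'.2 i hi]
  rw [hσ, segments_append_cons w h.1 hxo, segments_append_cons w h'.1 hyo, segments_even w h'.2,
    filter_append_cons w h.1 hxo, filter_append_cons w h'.1 hyo, h2]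

theorem IsEnum.mem_offDiag {x y : Fin n} (hx : IsEnum (odds w) [x, y]) :
    (x, y) ∈ (odds w).offDiag := by
  rw [Finset.mem_offDiag, ← hx.2]
  exact ⟨by simp, by simp, by simpa using hx.1⟩

theorem mem_range_twoOddMap (hO : (odds w).card = 2) {f : Equiv.Perm (Fin n) → F}
    (g g' : Fin n → Fin n → Finset (Fin n) → F)
    (hg : ∀ x y S, (w y).isSkew = false → g x y S = 0)
    (hg' : ∀ x y S, (w x).isSkew = false → g' x y S = 0)
    (hf : ∀ (σ : Equiv.Perm (Fin n)) (l₀ l₁ l₂ : List (Fin n)) (x y : Fin n),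
      IsEnum (evens w) (l₀ ++ (l₁ ++ l₂)) → IsEnum (odds w) [x, y] →
      List.ofFn σ = l₀ ++ x :: (l₁ ++ y :: l₂) →
      f σ = sgn F w l₁ * (g x y l₀.toFinset + g' x y l₂.toFinset)) :
    f ∈ LinearMap.range (twoOddMap F w) := by
  -- if both letters are skew, move the constants from `g'` to `g`
  let r : Fin n → Fin n → F := fun x y => if (w y).isSkew then g' x y ∅ else 0
  let u : (Σ _ : Fin n × Fin n, Finset (Fin n) ⊕ Finset (Fin n)) → F := fun c =>
    match c.2 with
    | Sum.inl S => g c.1.1 c.1.2 S + r c.1.1 c.1.2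
    | Sum.inr S => if (w c.1.1).isSkew then g' c.1.1 c.1.2 S - r c.1.1 c.1.2 else 0
  refine ⟨fun c => u c, ?_⟩
  ext σ
  obtain ⟨l₀, x, l₁, y, l₂, hσ, hE, hx⟩ := exists_split_two w hO (isEnum_ofFn σ)
  have hxy := hx.mem_offDiag w
  have hr : (w x).isSkew = false → r x y = 0 := by
    intro h
    simp only [r, hg' x y _ h, ite_self]
  have e1 : extendZero F (twoOddCoords w) (fun c => u c) ⟨(x, y), Sum.inl l₀.toFinset⟩ =
      g x y l₀.toFinset + r x y := by
    refine extendZero_restrict u fun h => ?_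
    have hy : (w y).isSkew = false := by
      by_contra hy
      exact h ((inl_mem_twoOddCoords w).2 ⟨hxy, by simpa using hy, hE.subset_left⟩)
    change g x y l₀.toFinset + r x y = 0
    simp only [hg x y _ hy, r, hy, Bool.false_eq_true, if_false, add_zero]
  have e2 : extendZero F (twoOddCoords w) (fun c => u c) ⟨(x, y), Sum.inr l₂.toFinset⟩ =
      g' x y l₂.toFinset - r x y := by
    have hu : u ⟨(x, y), Sum.inr l₂.toFinset⟩ = g' x y l₂.toFinset - r x y := by
      change (if (w x).isSkew then g' x y l₂.toFinset - r x y else 0) = _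
      split_ifs with h
      · rfl
      · have h : (w x).isSkew = false := by simpa using h
        rw [hr h, hg' x y _ h, sub_zero]
    rw [← hu]
    refine extendZero_restrict u fun h => ?_
    rw [hu]
    cases hxs : (w x).isSkew
    · rw [hr hxs, hg' x y _ hxs, sub_zero]
    · have h' : (w y).isSkew = true ∧ l₂.toFinset = ∅ := by
        by_contra hcon
        exact h ((inr_mem_twoOddCoords w).2
          ⟨hxy, hxs, (List.append_assoc l₀ l₁ l₂ ▸ hE).subset_right, fun hy h0 => hcon ⟨hy, h0⟩⟩)
      simp only [r, h'.1, h'.2, if_true, sub_self]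
  rw [twoOddMap_apply w _ hE hx hσ, hf σ _ _ _ _ _ hE hx hσ, e1, e2]
  ring

theorem range_twoOddMap (hO : (odds w).card = 2) :
    LinearMap.range (twoOddMap F w) = evalSpace F w := by
  have hne : ∀ i ∈ evens w, ∀ x ∈ odds w, i ≠ x := fun i hi x hx =>
    ne_of_mem_evens_of_mem_odds w hi hx
  have hval : ∀ (a b c : Fin n → F) (σ : Equiv.Perm (Fin n)) (l₀ l₁ l₂ : List (Fin n))
      (x y : Fin n), IsEnum (evens w) (l₀ ++ (l₁ ++ l₂)) → IsEnum (odds w) [x, y] →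
      List.ofFn σ = l₀ ++ x :: (l₁ ++ y :: l₂) →
      value w a b c (List.ofFn σ) = evenMat 0 0
        (sgn F w l₁ * (a x * (if (w y).isSkew then b y else 0) *
          (∏ i ∈ evens w \ l₀.toFinset, (w i).eps F) *
          ((∏ i ∈ l₀.toFinset, a i) * ∏ i ∈ evens w \ l₀.toFinset, b i)))
        (sgn F w l₁ * ((if (w x).isSkew then b x else 0) * ((w y).eps F * a y) *
          (∏ i ∈ l₂.toFinset, (w i).eps F) *
          ((∏ i ∈ l₂.toFinset, a i) * ∏ i ∈ evens w \ l₂.toFinset, b i))) 0 := by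
    intro a b c σ l₀ l₁ l₂ x y hE hx hσ
    have h := List.forall_mem_append.1 (hE.isOdd_eq_false w)
    have h' := List.forall_mem_append.1 h.2
    have hE' : IsEnum (evens w) (l₂ ++ (l₀ ++ l₁)) :=
      IsEnum.comm (l := l₀ ++ l₁) (r := l₂) (by rw [List.append_assoc]; exact hE)
    have e1 := hE.prod_right b
    have e2 := hE'.prod_right b
    have e3 := hE.sgn_right (F := F)
    have e4 := hE'.sgn_left (F := F)
    have e5 := sgn_mul_self (F := F) w l₁
    rw [List.map_append, List.prod_append] at e1 e2
    rw [sgn_append] at e3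
    rw [hσ, value_two_odd w a b c h.1 h'.1 h'.2 (hx.isOdd_eq_true w x (by simp))
      (hx.isOdd_eq_true w y (by simp)), ← e1, ← e2, ← e3, ← e4, ← hE.prod_left, ← hE'.prod_left]
    congr 1
    · linear_combination -(a x * (if (w y).isSkew then b y else 0) * sgn F w l₂ *
        ((l₀.map a).prod * ((l₁.map b).prod * (l₂.map b).prod))) * e5
    · ring
  apply le_antisymm
  · refine range_le_of_single _ ?_
    rintro ⟨⟨p, q⟩, S₀ | S₀⟩ h₀
    · obtain ⟨hpq, hqs, hS₀⟩ := (inl_mem_twoOddCoords w).1 h₀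
      obtain ⟨hp, hq, hpq'⟩ := Finset.mem_offDiag.1 hpq
      have hq0 : q ∉ insert p S₀ := by
        rw [Finset.mem_insert, not_or]
        exact ⟨fun h => hpq' h.symm, fun h => hne q (hS₀ h) q hq rfl⟩
      have hmem : ∀ i ∈ evens w, (i ∈ insert p S₀ ↔ i ∈ S₀) := fun i hi => by
        rw [Finset.mem_insert, or_iff_right (hne i hi p hp)]
      refine mem_evalSpace w (fun j => if j ∈ insert p S₀ then 1 else 0)
        (fun j => if j ∈ insert p S₀ then 0 else 1) 0 0 2
        (∏ j ∈ evens w \ S₀, (w j).eps F)⁻¹ fun σ => ?_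
      have h3 : (∏ j ∈ evens w \ S₀, (w j).eps F) ≠ 0 :=
        Finset.prod_ne_zero_iff.2 fun j _ => (w j).eps_ne_zero
      obtain ⟨l₀, x, l₁, y, l₂, hσ, hE, hx⟩ := exists_split_two w hO (isEnum_ofFn σ)
      have hind : ((∏ j ∈ l₀.toFinset, if j ∈ insert p S₀ then (1 : F) else 0) *
          ∏ j ∈ evens w \ l₀.toFinset, if j ∈ insert p S₀ then (0 : F) else 1) =
          if l₀.toFinset = S₀ then 1 else 0 := by
        rw [← prod_indicator hS₀]
        congr 1
        · exact Finset.prod_congr rfl fun j hj => if_congr (hmem j (hE.subset_left hj)) rfl rfl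
        · exact Finset.prod_congr rfl fun j hj =>
            if_congr (hmem j (Finset.mem_sdiff.1 hj).1) rfl rfl
      rw [hval _ _ _ σ l₀ l₁ l₂ x y hE hx hσ, twoOddMap_apply w _ hE hx hσ,
        extendZero_single h₀, extendZero_single h₀, hind]
      simp only [evenMat, Matrix.of_apply, Matrix.cons_val]
      by_cases hxp : x = p
      · have hyq : y = q := by
          have : q ∈ [x, y].toFinset := by rw [hx.2]; exact hq
          rw [hxp] at this
          simpa [Ne.symm hpq', eq_comm] using this
        subst hxp hyq
        by_cases hl : l₀.toFinset = S₀
        · simp [hl, hqs, hq0]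
          field_simp
        · simp [hl]
      · have hxq : x ∉ insert p S₀ := by
          rw [Finset.mem_insert, not_or]
          exact ⟨hxp, fun h => hne x (hS₀ h) x (by rw [← hx.2]; simp) rfl⟩
        simp [hxp, hxq]
    · obtain ⟨hpq, hps, hS₀, -⟩ := (inr_mem_twoOddCoords w).1 h₀
      obtain ⟨hp, hq, hpq'⟩ := Finset.mem_offDiag.1 hpq
      have hp0 : p ∉ insert q S₀ := by
        rw [Finset.mem_insert, not_or]
        exact ⟨hpq', fun h => hne p (hS₀ h) p hp rfl⟩
      have hmem : ∀ i ∈ evens w, (i ∈ insert q S₀ ↔ i ∈ S₀) := fun i hi => by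
        rw [Finset.mem_insert, or_iff_right (hne i hi q hq)]
      refine mem_evalSpace w (fun j => if j ∈ insert q S₀ then 1 else 0)
        (fun j => if j ∈ insert q S₀ then 0 else 1) 0 1 3
        ((w q).eps F * ∏ j ∈ S₀, (w j).eps F)⁻¹ fun σ => ?_
      have h3 : (∏ j ∈ S₀, (w j).eps F) ≠ 0 :=
        Finset.prod_ne_zero_iff.2 fun j _ => (w j).eps_ne_zero
      have h4 : (w q).eps F ≠ 0 := (w q).eps_ne_zero
      obtain ⟨l₀, x, l₁, y, l₂, hσ, hE, hx⟩ := exists_split_two w hO (isEnum_ofFn σ)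
      have hl₂ : l₂.toFinset ⊆ evens w := (List.append_assoc l₀ l₁ l₂ ▸ hE).subset_right
      have hind : ((∏ j ∈ l₂.toFinset, if j ∈ insert q S₀ then (1 : F) else 0) *
          ∏ j ∈ evens w \ l₂.toFinset, if j ∈ insert q S₀ then (0 : F) else 1) =
          if l₂.toFinset = S₀ then 1 else 0 := by
        rw [← prod_indicator hS₀]
        congr 1
        · exact Finset.prod_congr rfl fun j hj => if_congr (hmem j (hl₂ hj)) rfl rfl
        · exact Finset.prod_congr rfl fun j hj =>
            if_congr (hmem j (Finset.mem_sdiff.1 hj).1) rfl rfl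
      rw [hval _ _ _ σ l₀ l₁ l₂ x y hE hx hσ, twoOddMap_apply w _ hE hx hσ,
        extendZero_single h₀, extendZero_single h₀, hind]
      simp only [evenMat, Matrix.of_apply, Matrix.cons_val]
      by_cases hyq : y = q
      · have hxp : x = p := by
          have : p ∈ [x, y].toFinset := by rw [hx.2]; exact hp
          rw [hyq] at this
          simpa [hpq', eq_comm] using this
        subst hxp hyq
        by_cases hl : l₂.toFinset = S₀
        · simp [hl, hps, hp0]
          field_simp
        · simp [hl]
      · have hyq' : y ∉ insert q S₀ := by
          rw [Finset.mem_insert, not_or]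
          exact ⟨hyq, fun h => hne y (hS₀ h) y (by rw [← hx.2]; simp) rfl⟩
        simp [hyq, hyq']
  · rw [evalSpace, Submodule.span_le]
    rintro _ ⟨a, b, c, i, j, rfl⟩
    by_cases h1 : (i, j) = (0, 2)
    · obtain ⟨rfl, rfl⟩ := Prod.ext_iff.1 h1
      refine mem_range_twoOddMap w hO (fun x y S => a x * (if (w y).isSkew then b y else 0) *
        (∏ i ∈ evens w \ S, (w i).eps F) * ((∏ i ∈ S, a i) * ∏ i ∈ evens w \ S, b i))
        (fun _ _ _ => 0) (fun x y S h => by simp [h]) (fun _ _ _ _ => rfl)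
        fun σ l₀ l₁ l₂ x y hE hx hσ => ?_
      rw [hval a b c σ l₀ l₁ l₂ x y hE hx hσ, add_zero]
      rfl
    by_cases h2 : (i, j) = (1, 3)
    · obtain ⟨rfl, rfl⟩ := Prod.ext_iff.1 h2
      refine mem_range_twoOddMap w hO (fun _ _ _ => 0) (fun x y S =>
        (if (w x).isSkew then b x else 0) * ((w y).eps F * a y) *
        (∏ i ∈ S, (w i).eps F) * ((∏ i ∈ S, a i) * ∏ i ∈ evens w \ S, b i))
        (fun _ _ _ _ => rfl) (fun x y S h => by simp [h])
        fun σ l₀ l₁ l₂ x y hE hx hσ => ?_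
      rw [hval a b c σ l₀ l₁ l₂ x y hE hx hσ, zero_add]
      rfl
    refine mem_range_twoOddMap w hO (fun _ _ _ => 0) (fun _ _ _ => 0) (fun _ _ _ _ => rfl)
      (fun _ _ _ _ => rfl) fun σ l₀ l₁ l₂ x y hE hx hσ => ?_
    rw [hval a b c σ l₀ l₁ l₂ x y hE hx hσ, add_zero, mul_zero]
    fin_cases i <;> fin_cases j <;> first
      | rfl
      | exact mul_zero _
      | exact absurd rfl ‹_›

theorem twoOddMap_injective (hO : (odds w).card = 2) : Function.Injective (twoOddMap F w) := by
  rw [injective_iff_map_eq_zero]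
  intro u hu
  have hword : ∀ (x y : Fin n), (x, y) ∈ (odds w).offDiag → ∀ l₀ l₁ l₂ : List (Fin n),
      IsEnum (evens w) (l₀ ++ (l₁ ++ l₂)) →
      extendZero F _ u ⟨(x, y), Sum.inl l₀.toFinset⟩ +
        extendZero F _ u ⟨(x, y), Sum.inr l₂.toFinset⟩ = 0 := by
    intro x y hxy l₀ l₁ l₂ hE
    obtain ⟨hxO, hyO, hne⟩ := Finset.mem_offDiag.1 hxy
    have hx : IsEnum (odds w) [x, y] := by
      refine ⟨by simpa using hne, Finset.eq_of_subset_of_card_le ?_ ?_⟩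
      · intro i hi
        rcases (by simpa using hi : i = x ∨ i = y) with rfl | rfl <;> assumption
      · rw [hO, List.toFinset_card_of_nodup (by simpa using hne)]; rfl
    obtain ⟨σ, hσ⟩ := exists_perm_two w hE hx
    have := congrFun hu σ
    rw [twoOddMap_apply w _ hE hx hσ, Pi.zero_apply, mul_eq_zero,
      or_iff_right (sgn_ne_zero w _)] at this
    exact this
  have hl : ∀ (x y : Fin n), (x, y) ∈ (odds w).offDiag → ∀ S ⊆ evens w,
      extendZero F _ u ⟨(x, y), Sum.inl S⟩ + extendZero F _ u ⟨(x, y), Sum.inr ∅⟩ = 0 := by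
    intro x y hxy S hS
    simpa using hword x y hxy S.toList (evens w \ S).toList []
      (by simpa using isEnum_toList_append hS)
  have hr : ∀ (x y : Fin n), (x, y) ∈ (odds w).offDiag → ∀ S ⊆ evens w,
      extendZero F _ u ⟨(x, y), Sum.inl ∅⟩ + extendZero F _ u ⟨(x, y), Sum.inr S⟩ = 0 := by
    intro x y hxy S hS
    simpa using hword x y hxy [] (evens w \ S).toList S.toList
      (by simpa using (isEnum_toList_append hS).comm)
  ext ⟨⟨⟨x, y⟩, S⟩, hc⟩
  rw [← extendZero_mem u hc, Pi.zero_apply]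
  have hxy : (x, y) ∈ (odds w).offDiag := (Finset.mem_sigma.1 hc).1
  have hS0 := Finset.empty_subset (evens w)
  -- one of the coordinates `l₀ = ∅` and `l₂ = ∅` is missing
  by_cases h : (w y).isSkew = true
  · have h0 : extendZero F _ u ⟨(x, y), Sum.inr ∅⟩ = 0 :=
      extendZero_notMem u fun hm => ((inr_mem_twoOddCoords w).1 hm).2.2.2 h rfl
    have hl' : ∀ S ⊆ evens w, extendZero F _ u ⟨(x, y), Sum.inl S⟩ = 0 := by
      intro S hS
      simpa [h0] using hl x y hxy S hS
    rcases S with S | S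
    · exact hl' S ((inl_mem_twoOddCoords w).1 hc).2.2
    · simpa [hl' ∅ hS0] using hr x y hxy S ((inr_mem_twoOddCoords w).1 hc).2.2.1
  · have hl' : ∀ S, extendZero F _ u ⟨(x, y), Sum.inl S⟩ = 0 := fun S =>
      extendZero_notMem u fun hm => h ((inl_mem_twoOddCoords w).1 hm).2.1
    rcases S with S | S
    · exact hl' S
    · simpa [hl' ∅] using hr x y hxy S ((inr_mem_twoOddCoords w).1 hc).2.2.1

theorem finrank_evalSpace_twoOdd (hO : (odds w).card = 2) :
    Module.finrank F (evalSpace F w) +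
        (if ((odds w).filter fun i => (w i).isSkew).card = 2 then 2 else 0) =
      2 * ((odds w).filter fun i => (w i).isSkew).card * 2 ^ (evens w).card := by
  rw [← range_twoOddMap w hO, LinearMap.finrank_range_of_inj (twoOddMap_injective w hO),
    Module.finrank_fintype_fun_eq_card, Fintype.card_coe]
  obtain ⟨p, q, hpq, hO'⟩ := Finset.card_eq_two.1 hO
  have hoff : (odds w).offDiag = {(p, q), (q, p)} := by
    rw [hO']
    ext ⟨x, y⟩
    simp only [Finset.mem_offDiag, Finset.mem_insert, Finset.mem_singleton, Prod.mk.injEq]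
    constructor
    · rintro ⟨rfl | rfl, rfl | rfl, h⟩ <;> simp_all
    · rintro (⟨rfl, rfl⟩ | ⟨rfl, rfl⟩) <;> simp [hpq, Ne.symm hpq]
  have hc : ((evens w).powerset.erase ∅).card + 1 = 2 ^ (evens w).card := by
    rw [Finset.card_erase_add_one (Finset.empty_mem_powerset _), Finset.card_powerset]
  rw [twoOddCoords, Finset.card_sigma, hoff, Finset.sum_pair (by simp [hpq]), hO']
  simp only [Finset.card_disjSum, Finset.filter_insert, Finset.filter_singleton]
  cases hp : (w p).isSkew <;> cases hq : (w q).isSkew <;>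
    simp [hpq] <;> omega

end TwoOdd

/-! ### Words with three or more odd letters -/

section ThreeOdd

variable {F : Type*} [Field F] {n : ℕ} (w : Fin n → VarKind)

theorem exists_split_three (hO : (odds w).card = 3) {l : List (Fin n)}
    (hl : IsEnum Finset.univ l) :
    ∃ l₀ x l₁ y l₂ z l₃, l = l₀ ++ x :: (l₁ ++ y :: (l₂ ++ z :: l₃)) ∧
      IsEnum (evens w) ((l₁ ++ l₂) ++ (l₀ ++ l₃)) ∧ IsEnum (odds w) [x, y, z] := by
  have hf := hl.filter_isOdd w
  obtain ⟨x, y, z, hxy⟩ := List.length_eq_three.1 (hf.length_eq.trans hO)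
  obtain ⟨l₀, l', rfl, h₀, hxo, hr⟩ := exists_eq_append_cons w hxy
  obtain ⟨l₁, l', rfl, h₁, hyo, hr⟩ := exists_eq_append_cons w hr
  obtain ⟨l₂, l₃, rfl, h₂, hzo, hr⟩ := exists_eq_append_cons w hr
  have h₃ := isOdd_eq_false_of_filter_eq_nil w hr
  refine ⟨l₀, x, l₁, y, l₂, z, l₃, rfl, ?_, hxy ▸ hf⟩
  refine ((isEnum_univ_append_iff w (r := [x, y, z]) ?_ ?_).1 (hl.perm ?_)).1
  · simp only [List.mem_append]
    rintro i ((h | h) | (h | h))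
    exacts [h₁ i h, h₂ i h, h₀ i h, h₃ i h]
  · simpa using ⟨hxo, hyo, hzo⟩
  · rw [List.perm_iff_count]
    intro i
    simp only [List.count_append, List.count_cons, List.count_nil]
    omega

theorem exists_perm_three {l₀ l₁ l₂ l₃ : List (Fin n)} {x y z : Fin n}
    (hE : IsEnum (evens w) ((l₁ ++ l₂) ++ (l₀ ++ l₃))) (hx : IsEnum (odds w) [x, y, z]) :
    ∃ σ : Equiv.Perm (Fin n), List.ofFn σ = l₀ ++ x :: (l₁ ++ y :: (l₂ ++ z :: l₃)) := by
  have h := (isEnum_univ_append_iff w (hE.isOdd_eq_false w) (hx.isOdd_eq_true w)).2 ⟨hE, hx⟩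
  refine (h.perm ?_).exists_perm
  rw [List.perm_iff_count]
  intro i
  simp only [List.count_append, List.count_cons, List.count_nil]
  omega

/-- Coordinates for the functions on words `l₀ x l₁ y l₂ z l₃` with three odd letters: the middle
odd letter `y`, which has to be skew, and the set of the even letters between `x` and `z`. -/
def threeOddCoords : Finset (Fin n × Finset (Fin n)) :=
  ((odds w).filter fun i => (w i).isSkew) ×ˢ (evens w).powerset

theorem mem_threeOddCoords {y : Fin n} {S : Finset (Fin n)} :
    (y, S) ∈ threeOddCoords w ↔ (y ∈ odds w ∧ (w y).isSkew = true) ∧ S ⊆ evens w := by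
  simp [threeOddCoords]

variable (F) in
/-- The functions on words with three odd letters that depend, up to sign, only on the middle odd
letter and on the set of the even letters between the first and the last odd letter. -/
noncomputable def threeOddMap : (threeOddCoords w → F) →ₗ[F] (Equiv.Perm (Fin n) → F) where
  toFun u σ :=
    match segments w (List.ofFn σ), (List.ofFn σ).filter (fun i => (w i).isOdd) with
    | [_, l₁, l₂, l₃], [_, y, z] => sgn F w l₂ * sgn F w l₃ * (w z).eps F *
        extendZero F _ u (y, (l₁ ++ l₂).toFinset)
    | _, _ => 0
  map_add' u u' := by
    ext σ
    simp only [map_add, Pi.add_apply]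
    split
    · ring
    · simp
  map_smul' t u := by
    ext σ
    simp only [map_smul, Pi.smul_apply, smul_eq_mul, RingHom.id_apply]
    split
    · ring
    · simp

theorem threeOddMap_apply (u) {σ : Equiv.Perm (Fin n)} {l₀ l₁ l₂ l₃ : List (Fin n)}
    {x y z : Fin n} (hE : IsEnum (evens w) ((l₁ ++ l₂) ++ (l₀ ++ l₃)))
    (hx : IsEnum (odds w) [x, y, z])
    (hσ : List.ofFn σ = l₀ ++ x :: (l₁ ++ y :: (l₂ ++ z :: l₃))) :
    threeOddMap F w u σ = sgn F w l₂ * sgn F w l₃ * (w z).eps F *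
        extendZero F _ u (y, (l₁ ++ l₂).toFinset) := by
  change (match segments w (List.ofFn σ), (List.ofFn σ).filter (fun i => (w i).isOdd) with
    | [_, l₁, l₂, l₃], [_, y, z] => sgn F w l₂ * sgn F w l₃ * (w z).eps F *
        extendZero F _ u (y, (l₁ ++ l₂).toFinset)
    | _, _ => 0) = _
  have h := List.forall_mem_append.1 (hE.isOdd_eq_false w)
  have h' := List.forall_mem_append.1 h.1
  have h'' := List.forall_mem_append.1 h.2
  have hxo := hx.isOdd_eq_true w x (by simp)
  have hyo := hx.isOdd_eq_true w y (by simp)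
  have hzo := hx.isOdd_eq_true w z (by simp)
  have h3 : l₃.filter (fun i => (w i).isOdd) = [] :=
    List.filter_eq_nil_iff.2 fun i hi => by simp [h''.2 i hi]
  rw [hσ, segments_append_cons w h''.1 hxo, segments_append_cons w h'.1 hyo,
    segments_append_cons w h'.2 hzo, segments_even w h''.2, filter_append_cons w h''.1 hxo,
    filter_append_cons w h'.1 hyo, filter_append_cons w h'.2 hzo, h3]

theorem range_threeOddMap (hO : (odds w).card = 3) :
    LinearMap.range (threeOddMap F w) = evalSpace F w := by
  have hne : ∀ i ∈ evens w, ∀ x ∈ odds w, i ≠ x := fun i hi x hx =>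
    ne_of_mem_evens_of_mem_odds w hi hx
  have hval : ∀ (a b c : Fin n → F) (σ : Equiv.Perm (Fin n)) (l₀ l₁ l₂ l₃ : List (Fin n))
      (x y z : Fin n), IsEnum (evens w) ((l₁ ++ l₂) ++ (l₀ ++ l₃)) →
      IsEnum (odds w) [x, y, z] →
      List.ofFn σ = l₀ ++ x :: (l₁ ++ y :: (l₂ ++ z :: l₃)) →
      value w a b c (List.ofFn σ) = oddMat 0 0 0
        (sgn F w l₂ * sgn F w l₃ * (w z).eps F *
          ((∏ i ∈ (odds w).erase y, a i) * (if (w y).isSkew then b y else 0) *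
          ((∏ i ∈ (l₁ ++ l₂).toFinset, b i) * ∏ i ∈ evens w \ (l₁ ++ l₂).toFinset, a i))) := by
    intro a b c σ l₀ l₁ l₂ l₃ x y z hE hx hσ
    have h := List.forall_mem_append.1 (hE.isOdd_eq_false w)
    have h' := List.forall_mem_append.1 h.1
    have h'' := List.forall_mem_append.1 h.2
    have e1 := hE.prod_left b
    have e2 := hE.prod_right a
    rw [List.map_append, List.prod_append] at e1 e2
    obtain ⟨hxy, hxz, hyz⟩ : x ≠ y ∧ x ≠ z ∧ y ≠ z := by simpa [and_assoc] using hx.1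
    have e3 : (odds w).erase y = {x, z} := by
      rw [← hx.2]
      ext i
      simp only [List.toFinset_cons, List.toFinset_nil, Finset.mem_erase, Finset.mem_insert,
        Finset.mem_singleton]
      constructor
      · rintro ⟨h1, h2⟩; simpa [h1] using h2
      · rintro (rfl | rfl)
        exacts [⟨hxy, Or.inl rfl⟩, ⟨hyz.symm, by simp⟩]
    rw [hσ, value_three_odd w a b c h''.1 h'.1 h'.2 h''.2 (hx.isOdd_eq_true w x (by simp))
      (hx.isOdd_eq_true w y (by simp)) (hx.isOdd_eq_true w z (by simp)), ← e1, ← e2, e3,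
      Finset.prod_pair hxz]
    congr 1
    ring
  apply le_antisymm
  · refine range_le_of_single _ ?_
    rintro ⟨q, S₀⟩ h₀
    obtain ⟨⟨hq, hqs⟩, hS₀⟩ := (mem_threeOddCoords w).1 h₀
    have hmem : ∀ i ∈ evens w, (i ∈ insert q S₀ ↔ i ∈ S₀) := fun i hi => by
      rw [Finset.mem_insert, or_iff_right (hne i hi q hq)]
    refine mem_evalSpace w (fun j => if j ∈ insert q S₀ then 0 else 1)
      (fun j => if j ∈ insert q S₀ then 1 else 0) 0 0 3 1 fun σ => ?_
    obtain ⟨l₀, x, l₁, y, l₂, z, l₃, hσ, hE, hx⟩ := exists_split_three w hO (isEnum_ofFn σ)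
    have hind : ((∏ j ∈ (l₁ ++ l₂).toFinset, if j ∈ insert q S₀ then (1 : F) else 0) *
        ∏ j ∈ evens w \ (l₁ ++ l₂).toFinset, if j ∈ insert q S₀ then (0 : F) else 1) =
        if (l₁ ++ l₂).toFinset = S₀ then 1 else 0 := by
      rw [← prod_indicator hS₀]
      congr 1
      · exact Finset.prod_congr rfl fun j hj => if_congr (hmem j (hE.subset_left hj)) rfl rfl
      · exact Finset.prod_congr rfl fun j hj =>
          if_congr (hmem j (Finset.mem_sdiff.1 hj).1) rfl rfl
    rw [hval _ _ _ σ l₀ l₁ l₂ l₃ x y z hE hx hσ, threeOddMap_apply w _ hE hx hσ,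
      extendZero_single h₀, hind]
    simp only [oddMat, Matrix.of_apply, Matrix.cons_val, one_mul]
    congr 1
    by_cases hy : y = q
    · subst hy
      have h1 : (∏ i ∈ (odds w).erase y, if i ∈ insert y S₀ then (0 : F) else 1) = 1 := by
        refine Finset.prod_eq_one fun i hi => if_neg ?_
        obtain ⟨hi1, hi2⟩ := Finset.mem_erase.1 hi
        rw [Finset.mem_insert, not_or]
        exact ⟨hi1, fun h => hne i (hS₀ h) i hi2 rfl⟩
      rw [h1, hqs, if_pos rfl, if_pos (Finset.mem_insert_self _ _), one_mul, one_mul]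
      simp only [Prod.mk.injEq, true_and]
    · have h1 : (∏ i ∈ (odds w).erase y, if i ∈ insert q S₀ then (0 : F) else 1) = 0 :=
        Finset.prod_eq_zero (i := q) (Finset.mem_erase.2 ⟨fun h => hy h.symm, hq⟩)
          (if_pos (Finset.mem_insert_self _ _))
      rw [h1, zero_mul, zero_mul, if_neg]
      intro h
      exact hy (Prod.ext_iff.1 h).1
  · rw [evalSpace, Submodule.span_le]
    rintro _ ⟨a, b, c, i, j, rfl⟩
    by_cases h1 : (i, j) = (0, 3)
    · obtain ⟨rfl, rfl⟩ := Prod.ext_iff.1 h1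
      let g : Fin n × Finset (Fin n) → F := fun p =>
        (∏ i ∈ (odds w).erase p.1, a i) * (if (w p.1).isSkew then b p.1 else 0) *
          ((∏ i ∈ p.2, b i) * ∏ i ∈ evens w \ p.2, a i)
      refine ⟨fun p => g p, ?_⟩
      ext σ
      obtain ⟨l₀, x, l₁, y, l₂, z, l₃, hσ, hE, hx⟩ := exists_split_three w hO (isEnum_ofFn σ)
      rw [hval _ _ _ σ l₀ l₁ l₂ l₃ x y z hE hx hσ, threeOddMap_apply w _ hE hx hσ,
        extendZero_restrict g]
      · rfl
      · intro h
        have hy : ¬ (w y).isSkew = true := fun hy => h ((mem_threeOddCoords w).2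
          ⟨⟨by rw [← hx.2]; simp, hy⟩, hE.subset_left⟩)
        simp only [g, if_neg hy, mul_zero, zero_mul]
    · refine ⟨0, ?_⟩
      rw [map_zero]
      ext σ
      obtain ⟨l₀, x, l₁, y, l₂, z, l₃, hσ, hE, hx⟩ := exists_split_three w hO (isEnum_ofFn σ)
      rw [hval _ _ _ σ l₀ l₁ l₂ l₃ x y z hE hx hσ]
      fin_cases i <;> fin_cases j <;> first
        | rfl
        | exact absurd rfl ‹_›

theorem threeOddMap_injective (hO : (odds w).card = 3) :
    Function.Injective (threeOddMap F w) := by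
  rw [injective_iff_map_eq_zero]
  intro u hu
  ext ⟨⟨y, S⟩, hc⟩
  obtain ⟨⟨hy, -⟩, hS⟩ := (mem_threeOddCoords w).1 hc
  obtain ⟨x, z, hxz, hyO⟩ := Finset.card_eq_two.1
    (show ((odds w).erase y).card = 2 by rw [Finset.card_erase_of_mem hy, hO])
  have hO' : odds w = insert y {x, z} := by rw [← hyO, Finset.insert_erase hy]
  have hxy : x ≠ y := Finset.ne_of_mem_erase (by rw [hyO]; simp)
  have hzy : z ≠ y := Finset.ne_of_mem_erase (by rw [hyO]; simp)
  have hx : IsEnum (odds w) [x, y, z] := by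
    refine ⟨by simp [hxy, hxz, hzy.symm], ?_⟩
    rw [hO', Finset.insert_comm]
    simp
  have hE : IsEnum (evens w) ((S.toList ++ []) ++ ([] ++ (evens w \ S).toList)) := by
    simpa using isEnum_toList_append hS
  obtain ⟨σ, hσ⟩ := exists_perm_three w hE hx
  have := congrFun hu σ
  rw [threeOddMap_apply w _ hE hx hσ, List.append_nil, Finset.toList_toFinset, extendZero_mem _ hc,
    Pi.zero_apply, mul_eq_zero, or_iff_right] at this
  · exact this
  · exact mul_ne_zero (mul_ne_zero (sgn_ne_zero w _) (sgn_ne_zero w _)) (w z).eps_ne_zero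

theorem finrank_evalSpace_threeOdd (hO : (odds w).card = 3) :
    Module.finrank F (evalSpace F w) =
      ((odds w).filter fun i => (w i).isSkew).card * 2 ^ (evens w).card := by
  rw [← range_threeOddMap w hO, LinearMap.finrank_range_of_inj (threeOddMap_injective w hO),
    Module.finrank_fintype_fun_eq_card, Fintype.card_coe, threeOddCoords, Finset.card_product,
    Finset.card_powerset]

theorem finrank_evalSpace_manyOdd (hO : 4 ≤ (odds w).card) :
    Module.finrank F (evalSpace F w) = 0 := by
  have : evalSpace F w = ⊥ := by
    rw [evalSpace, Submodule.span_eq_bot]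
    rintro _ ⟨a, b, c, i, j, rfl⟩
    ext σ
    refine value_eq_zero_of_lt w a b c _ i j ?_
    rw [((isEnum_ofFn σ).filter_isOdd w).length_eq]
    omega
  rw [this, finrank_bot]

end ThreeOdd

/-! ### Summation over the kinds of variables -/

section Summation

variable {n : ℕ}

/-- The rank of a multihomogeneous component of degree `n` with `k` odd variables, `s` of which are
skew. For `1 ≤ n` and `k ≤ n` the truncated exponents are harmless: `n - 2` is negative for
`n = k = 1` only, and there the factor `n - 1` vanishes. -/
def rankFormula (n k s : ℕ) : ℚ :=
  match k with
  | 0 => n * 2 ^ (n - 1) - 2 ^ n + 2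
  | 1 => 1 + (n - 1 : ℕ) * 2 ^ (n - 2)
  | 2 => 2 * s * 2 ^ (n - 2) - if s = 2 then 2 else 0
  | 3 => s * 2 ^ (n - 3)
  | _ => 0

/-- The indices of the skew variables. -/
def skews (w : Fin n → VarKind) : Finset (Fin n) :=
  Finset.univ.filter fun i => (w i).isSkew = true

theorem card_odds_add_card_evens (w : Fin n → VarKind) :
    (odds w).card + (evens w).card = n := by
  have h := Finset.card_filter_add_card_filter_not (s := (Finset.univ : Finset (Fin n)))
    (fun i => (w i).isOdd = true)
  simp only [Bool.not_eq_true, Finset.card_univ, Fintype.card_fin] at h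
  exact h

theorem finrank_evalSpace (F : Type*) [Field F] (hn : 0 < n) (w : Fin n → VarKind) :
    (Module.finrank F (evalSpace F w) : ℚ) =
      rankFormula n (odds w).card (odds w ∩ skews w).card := by
  have hs : ((odds w).filter fun i => (w i).isSkew = true) = odds w ∩ skews w := by
    ext i; simp [skews]
  have hc := card_odds_add_card_evens w
  rcases h : (odds w).card with _ | _ | _ | _ | k
  · have h0 : ∀ i, (w i).isOdd = false := by
      intro i
      by_contra hi
      have : i ∈ odds w := by simpa [odds] using hi
      rw [Finset.card_eq_zero.1 h] at this
      simp at this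
    have h1 := finrank_evalSpace_noOdd (F := F) w hn h0
    have h2 : 2 ≤ 2 ^ n := Nat.le_self_pow hn.ne' 2
    zify [h2] at h1
    have h3 := congrArg (fun z : ℤ => (z : ℚ)) h1
    push_cast at h3
    simp only [rankFormula]
    linear_combination h3
  · have he : (evens w).card = n - 1 := by omega
    rw [finrank_evalSpace_oneOdd w h, he, Nat.sub_sub]
    simp [rankFormula]
  · have he : (evens w).card = n - 2 := by omega
    have h1 := finrank_evalSpace_twoOdd (F := F) w h
    rw [he, hs] at h1
    have h2 := congrArg (fun z : ℕ => (z : ℚ)) h1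
    push_cast at h2
    simp only [rankFormula]
    linear_combination h2
  · have he : (evens w).card = n - 3 := by omega
    rw [finrank_evalSpace_threeOdd w h, he, hs]
    simp [rankFormula]
  · rw [finrank_evalSpace_manyOdd w (by omega)]
    simp [rankFormula]

/-- Kinds of variables are described by the sets of the odd and of the skew indices. -/
theorem bijective_odds_skews :
    Function.Bijective fun w : Fin n → VarKind => (odds w, skews w) := by
  constructor
  · intro w w' h
    obtain ⟨h1, h2⟩ := Prod.ext_iff.1 h
    ext i
    have e1 := Finset.ext_iff.1 h1 i
    have e2 := Finset.ext_iff.1 h2 i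
    simp only [odds, skews, Finset.mem_filter, Finset.mem_univ, true_and] at e1 e2
    revert e1 e2
    cases w i <;> cases w' i <;> simp [VarKind.isOdd, VarKind.isSkew]
  · rintro ⟨O, K⟩
    refine ⟨fun i => if i ∈ O then if i ∈ K then .oddSkew else .oddSymm
      else if i ∈ K then .evenSkew else .evenSymm, Prod.ext ?_ ?_⟩ <;>
    · ext i
      simp only [odds, skews, Finset.mem_filter, Finset.mem_univ, true_and]
      by_cases h1 : i ∈ O <;> by_cases h2 : i ∈ K <;>
        simp [h1, h2, VarKind.isOdd, VarKind.isSkew]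

theorem sum_card_inter {M : Type*} [AddCommMonoid M] (O : Finset (Fin n)) (g : ℕ → M) :
    ∑ K : Finset (Fin n), g (O ∩ K).card =
      2 ^ (n - O.card) • ∑ A ∈ O.powerset, g A.card := by
  rw [← Finset.sum_fiberwise_of_maps_to (s := Finset.univ) (t := O.powerset)
    (g := fun K => O ∩ K) (fun K _ => Finset.mem_powerset.2 Finset.inter_subset_left),
    Finset.smul_sum]
  refine Finset.sum_congr rfl fun A hA => ?_
  rw [Finset.mem_powerset] at hA
  have hd : Disjoint A Oᶜ := disjoint_compl_right.mono_left hA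
  have hf : Finset.univ.filter (fun K => O ∩ K = A) = Finset.Icc A (A ∪ Oᶜ) := by
    ext K
    simp only [Finset.mem_filter, Finset.mem_univ, true_and, Finset.mem_Icc]
    constructor
    · rintro rfl
      refine ⟨Finset.inter_subset_right, fun i hi => ?_⟩
      by_cases hiO : i ∈ O <;> simp [hi, hiO]
    · rintro ⟨h1, h2⟩
      refine Finset.Subset.antisymm (fun i hi => ?_) (Finset.subset_inter hA h1)
      have := h2 (Finset.mem_of_mem_inter_right hi)
      simpa [Finset.mem_of_mem_inter_left hi] using this
  rw [Finset.sum_congr rfl fun K hK => by rw [(Finset.mem_filter.1 hK).2], Finset.sum_const, hf,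
    Finset.card_Icc_finset Finset.subset_union_left, Finset.card_union_of_disjoint hd,
    Nat.add_sub_cancel_left, Finset.card_compl, Fintype.card_fin]

/-- The codimension as a sum over the number of odd variables. -/
theorem codimension_eq_sum_choose (F : Type*) [Field F] [CharZero F] (hn : 0 < n) :
    ((superSymplectic F).codimension n : ℚ) =
      ∑ k ∈ Finset.range 4, (n.choose k : ℚ) * (2 ^ (n - k) *
        ∑ s ∈ Finset.range (k + 1), (k.choose s : ℚ) * rankFormula n k s) := by
  have h1 : ((superSymplectic F).codimension n : ℚ) =
      ∑ p : Finset (Fin n) × Finset (Fin n), rankFormula n p.1.card (p.1 ∩ p.2).card := by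
    rw [codimension_eq_sum, Nat.cast_sum]
    exact Fintype.sum_bijective _ bijective_odds_skews _ _ fun w => finrank_evalSpace F hn w
  let G : ℕ → ℚ := fun k => 2 ^ (n - k) *
    ∑ s ∈ Finset.range (k + 1), (k.choose s : ℚ) * rankFormula n k s
  have h2 : ∀ O : Finset (Fin n), ∑ K : Finset (Fin n), rankFormula n O.card (O ∩ K).card =
      G O.card := by
    intro O
    rw [sum_card_inter O (rankFormula n O.card),
      Finset.sum_powerset_apply_card (rankFormula n O.card)]
    simp [G, nsmul_eq_mul]
  rw [h1, Fintype.sum_prod_type]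
  simp only [h2]
  rw [← Finset.powerset_univ, Finset.sum_powerset_apply_card G, Finset.card_univ,
    Fintype.card_fin]
  simp only [nsmul_eq_mul]
  change ∑ k ∈ Finset.range (n + 1), (n.choose k : ℚ) * G k =
    ∑ k ∈ Finset.range 4, (n.choose k : ℚ) * G k
  -- both sums reduce to the indices `k ≤ n` with `k < 4`
  have h4 : ∀ k, 4 ≤ k → G k = 0 := by
    intro k hk
    obtain ⟨k, rfl⟩ := Nat.exists_eq_add_of_le' hk
    simp [G, rankFormula]
  rcases le_total 4 (n + 1) with h | h
  · refine (Finset.sum_subset (Finset.range_mono h) fun k _ hk => ?_).symm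
    rw [h4 k (by simpa using hk), mul_zero]
  · refine Finset.sum_subset (Finset.range_mono h) fun k _ hk => ?_
    rw [Nat.choose_eq_zero_of_lt (by simpa using hk), Nat.cast_zero, zero_mul]

theorem codimension_formula (F : Type*) [Field F] [CharZero F] (hn : 1 ≤ n) :
    ((superSymplectic F).codimension n : ℚ) =
      2 ^ n * (n + 2) - 2 ^ n / 4 * n * (n - 1) + (2 ^ n) ^ 2 / 2 * ((n : ℚ) ^ 2 - 2)
        + (2 ^ n) ^ 2 / 32 * n * (n - 1) * (n - 2) := by
  rw [codimension_eq_sum_choose F hn]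
  simp only [Finset.sum_range_succ, Finset.sum_range_zero, rankFormula, Nat.cast_choose_two]
  match n, hn with
  | 1, _ => norm_num [Nat.choose]
  | 2, _ => norm_num [Nat.choose]
  | m + 3, _ =>
    have s1 : m + 3 - 1 = m + 2 := rfl
    have s2 : m + 3 - 2 = m + 1 := rfl
    have s3 : m + 3 - 3 = m := rfl
    have c3 : ((m + 3).choose 3 : ℚ) = (m + 3) * (m + 2) * (m + 1) / 6 := by
      have h := Nat.descFactorial_eq_factorial_mul_choose (m + 3) 3
      simp only [Nat.descFactorial_succ, Nat.descFactorial_zero, s1, s2, Nat.sub_zero,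
        Nat.factorial] at h
      have h' := congrArg (fun z : ℕ => (z : ℚ)) h
      push_cast at h'
      linear_combination -h' / 6
    rw [s1, s2, s3, c3]
    norm_num
    ring

end Summation

/-! ### The exponent -/

section Exponent

open Filter Topology

theorem codimension_bounds (F : Type*) [Field F] [CharZero F] {n : ℕ} (hn : 3 ≤ n) :
    (4 : ℝ) ^ n ≤ (superSymplectic F).codimension n ∧
      ((superSymplectic F).codimension n : ℝ) ≤ (n : ℝ) ^ 3 * 4 ^ n := by
  have hf := codimension_formula F (n := n) (by omega)
  have hT : (8 : ℚ) ≤ 2 ^ n := by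
    calc (8 : ℚ) = 2 ^ 3 := by norm_num
      _ ≤ 2 ^ n := pow_le_pow_right₀ (by norm_num) hn
  have h4 : (4 : ℚ) ^ n = (2 ^ n) ^ 2 := by
    rw [← pow_mul, mul_comm, pow_mul]; norm_num
  have hx : (3 : ℚ) ≤ n := by exact_mod_cast hn
  have key : (4 : ℚ) ^ n ≤ (superSymplectic F).codimension n ∧
      ((superSymplectic F).codimension n : ℚ) ≤ (n : ℚ) ^ 3 * 4 ^ n := by
    rw [h4, hf]
    generalize (n : ℚ) = x at *
    generalize (2 : ℚ) ^ n = T at *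
    have hT0 : 0 ≤ T := by linarith
    have p1 : 0 ≤ T * (T - 8) := mul_nonneg hT0 (by linarith)
    have p2 : 0 ≤ x * (x - 1) := mul_nonneg (by linarith) (by linarith)
    have p3 : 0 ≤ x * (x - 1) * (x - 2) := mul_nonneg p2 (by linarith)
    have p4 : 0 ≤ T ^ 2 := sq_nonneg T
    constructor
    · have q1 : 0 ≤ T * (T - 8) * (x * (x - 1)) := mul_nonneg p1 p2
      have q2 : 0 ≤ T * (x * (x - 1)) := mul_nonneg hT0 p2
      have q3 : 0 ≤ T ^ 2 * (x * (x - 1) * (x - 2)) := mul_nonneg p4 p3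
      have q4 : 0 ≤ T ^ 2 * (x ^ 2 / 4 + x / 4 - 2) := mul_nonneg p4 (by nlinarith)
      have q5 : 0 ≤ T * (x + 2) := mul_nonneg hT0 (by linarith)
      nlinarith
    · have q1 : 0 ≤ T * (T - 8) * (x + 2) := mul_nonneg p1 (by linarith)
      have q2 : 0 ≤ T * (x * (x - 1)) := mul_nonneg hT0 p2
      have r2 : 9 ≤ x ^ 2 := by nlinarith
      have r3 : 3 * x ^ 2 ≤ x ^ 3 := by nlinarith
      have q3 : 0 ≤ T ^ 2 * (x ^ 3 - (x + 2) / 8 - (x ^ 2 - 2) / 2 - x * (x - 1) * (x - 2) / 32) :=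
        mul_nonneg p4 (by nlinarith)
      nlinarith
  constructor
  · exact_mod_cast key.1
  · exact_mod_cast key.2

theorem tendsto_codimension_rpow (F : Type*) [Field F] [CharZero F] :
    Tendsto (fun n : ℕ => ((superSymplectic F).codimension n : ℝ) ^ (1 / (n : ℝ))) atTop
      (𝓝 4) := by
  have hroot : Tendsto (fun n : ℕ => (n : ℝ) ^ (1 / (n : ℝ))) atTop (𝓝 1) :=
    tendsto_rpow_div.comp tendsto_natCast_atTop_atTop
  have hupper : Tendsto (fun n : ℕ => ((n : ℝ) ^ (1 / (n : ℝ))) ^ 3 * 4) atTop (𝓝 4) := by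
    simpa using (hroot.pow 3).mul_const 4
  refine tendsto_of_tendsto_of_tendsto_of_le_of_le' tendsto_const_nhds hupper ?_ ?_
  · filter_upwards [eventually_ge_atTop 3] with n hn
    have h := Real.rpow_le_rpow (by positivity) (codimension_bounds F hn).1
      (by positivity : (0 : ℝ) ≤ 1 / n)
    rwa [one_div, Real.pow_rpow_inv_natCast (by norm_num) (by omega), ← one_div] at h
  · filter_upwards [eventually_ge_atTop 3] with n hn
    have h := Real.rpow_le_rpow (by positivity) (codimension_bounds F hn).2
      (by positivity : (0 : ℝ) ≤ 1 / n)
    rw [Real.mul_rpow (by positivity) (by positivity)] at h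
    nth_rewrite 3 [one_div] at h
    rw [Real.pow_rpow_inv_natCast (by norm_num) (by omega), ← Real.rpow_natCast (n : ℝ),
      ← Real.rpow_mul (by positivity), mul_comm ((3 : ℕ) : ℝ), Real.rpow_mul (by positivity),
      Real.rpow_natCast] at h
    exact h

end Exponent

end SuperStar

theorem mainTheorem2 (F : Type*) [Field F] [CharZero F] :
    (∀ n : ℕ, 1 ≤ n →
      ((SuperStar.superSymplectic F).codimension n : ℚ) =
        (2 : ℚ) ^ n * (n + 2) - (2 : ℚ) ^ ((n : ℤ) - 2) * n * (n - 1)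
          + (2 : ℚ) ^ (2 * (n : ℤ) - 1) * ((n : ℚ) ^ 2 - 2)
          + (2 : ℚ) ^ (2 * (n : ℤ) - 5) * n * (n - 1) * (n - 2)) ∧
    Filter.Tendsto
      (fun n : ℕ => ((SuperStar.superSymplectic F).codimension n : ℝ) ^ (1 / (n : ℝ)))
      Filter.atTop (nhds 4) := by
  refine ⟨fun n hn => ?_, SuperStar.tendsto_codimension_rpow F⟩
  have e2 : (2 : ℚ) ^ ((n : ℤ) - 2) = 2 ^ n / 4 := by
    rw [zpow_sub₀ two_ne_zero, zpow_natCast]; norm_num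
  have e1 : (2 : ℚ) ^ (2 * (n : ℤ) - 1) = (2 ^ n) ^ 2 / 2 := by
    rw [zpow_sub₀ two_ne_zero, mul_comm, zpow_mul, zpow_natCast]; norm_num
  have e5 : (2 : ℚ) ^ (2 * (n : ℤ) - 5) = (2 ^ n) ^ 2 / 32 := by
    rw [zpow_sub₀ two_ne_zero, mul_comm, zpow_mul, zpow_natCast]; norm_num
  rw [e2, e1, e5]
  exact SuperStar.codimension_formula F hn
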